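/- Let $\mathbb{F}_q$ be a finite field with $q=2^s$, $s\ge 1$, and let $m\ge 1$. Put $S_m=\mathbb{F}_q[y_1,\dots,y_m,x_m,\dots,x_1]$ and $S_m[z]$ for the polynomial ring in the further variable $z$, i.e. the ring of polynomial functions on $V=\mathbb{F}_q^{2m+1}$. Let $$\overline{\xi}_0=\sum_{j=1}^m x_jy_j,\qquad \xi_0=z^2+\overline{\xi}_0,\qquad \xi_i=\sum_{j=1}^m\bigl(x_jy_j^{q^i}+y_jx_j^{q^i}\bigr)\quad(i>0),$$ and let $O_{2m+1}(\mathbb{F}_q)$ be the subgroup of $GL_{2m+1}(\mathbb{F}_q)$ fixing $\xi_0$ under linear substitution. *Steenrod operations.* Let $\mathcal{P}(t):S_m[z]\to S_m[z][t]$ be the $\mathbb{F}_q$-algebra homomorphism with $v\mapsto v+v^qt$ for every linear form $v$, and let $\mathcal{P}^k(f)$ be the coefficient of $t^k$ in $\mathcal{P}(t)(f)$. *Dickson invariants.* Let $d_{1,m}\in S_m$ be the coefficient of $t^{q^{2m-1}-1}$ in $\prod_v(t+v)$, where $v$ runs over the nonzero $\mathbb{F}_q$-linear forms in $S_m$. With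 $(w_1,\dots,w_{2m})=(x_1,\dots,x_m,y_m,\dots,y_1)$ let $$u_m=\prod_{k=1}^{2m}\ \prod_{a\in\mathbb{F}_q^{k-1}}\Bigl(w_k+\sum_{j<k}a_jw_j\Bigr)\in S_m,\qquad u_0=1.$$ *Natural monomials.* A monomial $\xi_1^{j_1}\cdots\xi_i^{j_i}$ is natural if all base-$q$ digits of all the exponents $j_k$ are $0$ or $1$; its natural degree is the total number of digits equal to $1$, and its degree is $\sum_k j_k(q^k+1)$. Let $U$ be the sum of the natural monomials in $\xi_1,\dots,\xi_{2m-3}$ of degree $1+q+\cdots+q^{2m-3}$ and natural degree $m-1$ (so $U=1$ if $m=1$). For $0<j<k<2m-1$ let $\delta_{jk}$ be the sum of the natural monomials in $\xi_1,\dots,\xi_{2m-2}$ of degree $q+q^2+\cdots+q^{2m-2}-q^j-q^k$ and natural degree $m-2$, and let $\delta_1=\sum_{0<j<k<2m-1}\xi_j\xi_k\delta_{jk}\in S_m$ (so $\delta_1=0$ if $m=1$). Then the following hold. 1. When the $\xi_i$ are taken in $S_{m-1}$, the formal expression $U$ equals $u_{m-1}$; accordingly the value of $U$ at the $\xi_i\in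 S_m$ is again denoted $u_{m-1}\in S_m$. 2. There is exactly one $b_1\in S_m[z]$ with $b_1^2=d_{1,m}+u_m^{q-2}\bigl(\delta_1+\overline{\xi}_0\,u_{m-1}^q\bigr)$. 3. Put $e_1=u_m^{q/2-1}u_{m-1}^{q/2}z+b_1$ and $e_{i+1}=\mathcal{P}^{q^{2m-1-i}/2}(e_i)$ for $1\le i<m$. Then $$\mathcal{H}=\{\xi_0,\xi_1,\dots,\xi_m,e_1,\dots,e_m\}$$ is a homogeneous system of parameters for the ring of invariants $S_m[z]^{O_{2m+1}(\mathbb{F}_q)}$: its $2m+1$ members are invariant, homogeneous of positive degree and algebraically independent over $\mathbb{F}_q$, and $S_m[z]^{O_{2m+1}(\mathbb{F}_q)}$ is a finitely generated module over $\mathbb{F}_q[\mathcal{H}]$. Moreover the common zero set of $\mathcal{H}$ in $\overline{\mathbb{F}_q}^{\,2m+1}$ is $\{0\}$. -/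

import Mathlib

noncomputable section

open MvPolynomial

namespace OddOrth

/-- The coordinate functions on `V = F ^ (2m+1)`: `y i`, then `z`, then `x i`. -/
abbrev Var (m : ℕ) : Type := Fin m ⊕ Unit ⊕ Fin m

/-- The polynomial ring `S[z] = F[y₁, …, y_m, z, x_m, …, x₁]`. -/
abbrev Sz (F : Type*) [Field F] (m : ℕ) : Type _ := MvPolynomial (Var m) F

section Group

variable (F : Type*) [Field F]

/-- The variable `y_{i+1}`. -/
def y (m : ℕ) (i : Fin m) : Sz F m := X (Sum.inl i)

/-- The variable `z`. -/
def z (m : ℕ) : Sz F m := X (Sum.inr (Sum.inl ()))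

/-- The variable `x_{i+1}`. -/
def x (m : ℕ) (i : Fin m) : Sz F m := X (Sum.inr (Sum.inr i))

/-- `x₁ y₁ + ⋯ + x_m y_m`. -/
def xiBar (m : ℕ) : Sz F m := ∑ j, x F m j * y F m j

/-- The quadratic form `ξ₀ = z² + x₁ y₁ + ⋯ + x_m y_m`. -/
def xiZero (m : ℕ) : Sz F m := z F m ^ 2 + xiBar F m

variable {F}

/-- Linear substitution: `subst g f` is the polynomial `v ↦ f (g v)`. -/
def subst {m : ℕ} (g : Matrix (Var m) (Var m) F) : Sz F m →ₐ[F] Sz F m :=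
  aeval fun i => ∑ j, C (g i j) * X j

theorem subst_one {m : ℕ} : subst (1 : Matrix (Var m) (Var m) F) = AlgHom.id F _ := by
  apply MvPolynomial.algHom_ext
  intro i
  simp only [subst, aeval_X, AlgHom.id_apply]
  rw [Finset.sum_eq_single i]
  · simp
  · intro b _ hb
    simp [Matrix.one_apply_ne hb.symm]
  · simp

theorem subst_mul {m : ℕ} (g h : Matrix (Var m) (Var m) F) (f : Sz F m) :
    subst (g * h) f = subst h (subst g f) := by
  have key : subst (g * h) = (subst h).comp (subst g) := by
    apply MvPolynomial.algHom_ext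
    intro i
    simp only [subst, aeval_X, AlgHom.comp_apply, map_sum, map_mul, Matrix.mul_apply,
      Finset.sum_mul, algHom_C, Finset.mul_sum, MvPolynomial.algebraMap_eq]
    rw [Finset.sum_comm]
    simp only [mul_assoc]
  rw [key, AlgHom.comp_apply]

variable (F)

/-- The orthogonal group `O_{2m+1}(F)`: the subgroup of `GL_{2m+1}(F)` fixing `ξ₀`. -/
def orthGroup (m : ℕ) : Subgroup (Matrix.GeneralLinearGroup (Var m) F) where
  carrier := {g | subst g.val (xiZero F m) = xiZero F m}
  one_mem' := by simp [subst_one]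
  mul_mem' := by
    intro g h hg hh
    simp only [Set.mem_ofPred_eq, Units.val_mul, subst_mul] at *
    rw [hg, hh]
  inv_mem' := by
    intro g hg
    simp only [Set.mem_ofPred_eq] at *
    conv_lhs => rw [← hg]
    rw [← subst_mul, Units.mul_inv, subst_one, AlgHom.id_apply]

/-- The ring of invariants `S[z]^{O_{2m+1}(F)}`. -/
def orthInvariants (m : ℕ) : Subalgebra F (Sz F m) where
  carrier := {f | ∀ g ∈ orthGroup F m, subst g.val f = f}
  mul_mem' := by
    intro a b ha hb g hg
    rw [map_mul, ha g hg, hb g hg]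
  add_mem' := by
    intro a b ha hb g hg
    rw [map_add, ha g hg, hb g hg]
  algebraMap_mem' := by
    intro r g _
    exact (subst g.val).commutes r

end Group

/-- A family `f` is a homogeneous system of parameters for a subalgebra `A` of a polynomial
ring: its members are elements of `A`, homogeneous of positive degree and algebraically
independent, and `A` is a finitely generated module over the polynomial algebra `F[f]`. -/
def IsHSOP {F σ ι : Type*} [Field F] (A : Subalgebra F (MvPolynomial σ F))
    (f : ι → MvPolynomial σ F) : Prop :=
  ∃ hA : ∀ i, f i ∈ A,
    (∀ i, ∃ d : ℕ, 0 < d ∧ (f i).IsHomogeneous d) ∧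
    AlgebraicIndependent F f ∧
    (aeval (fun i => (⟨f i, hA i⟩ : A)) : MvPolynomial ι F →ₐ[F] A).Finite

variable (F : Type*) [Field F] [Fintype F]

/-- The complete Steenrod operator `P(t)`, the algebra homomorphism `S[z] → S[z][t]` with
`v ↦ v + v^q t` on linear forms. -/
def steenrodTotal (m : ℕ) : Sz F m →ₐ[F] Polynomial (Sz F m) :=
  aeval fun i => Polynomial.C (X i) + Polynomial.C (X i ^ Fintype.card F) * Polynomial.X

/-- The Steenrod operation `P^k`: the coefficient of `t^k` in `P(t)`. -/
def steenrod (m k : ℕ) (f : Sz F m) : Sz F m := (steenrodTotal F m f).coeff k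

/-- The invariants `ξ_i`: the quadratic form for `i = 0`, and
`ξ_i = ∑ j, (x_j y_j^(q^i) + y_j x_j^(q^i))` for `i > 0`. -/
def xi (m : ℕ) : ℕ → Sz F m
  | 0 => xiZero F m
  | i + 1 => ∑ j, (x F m j * y F m j ^ Fintype.card F ^ (i + 1)
      + y F m j * x F m j ^ Fintype.card F ^ (i + 1))

/-- The variables of `S` in the order `x₁, …, x_m, y_m, …, y₁`. -/
def w (m : ℕ) : Fin (m + m) → Sz F m := Fin.append (x F m) fun i => y F m i.rev

/-- The orbit product `N(w_k)` over the unipotent triangular group: the orbit of `w_k` is the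
set of all `w_k + ∑_{j < k} a_j w_j`. -/
def orbitProd (m : ℕ) (k : Fin (m + m)) : Sz F m :=
  ∏ a : Fin k → F, (w F m k + ∑ j : Fin k, C (a j) * w F m (Fin.castLE k.isLt.le j))

/-- `u_m`, the product of the orbit products `N(x_i)` and `N(y_i)`. -/
def u (m : ℕ) : Sz F m := ∏ k, orbitProd F m k

open Classical in
/-- The Dickson invariant `d_{i,m}` of `GL_{2m}(F)` acting on `S`: the coefficient of
`t^(q^(2m-i)-1)` in the product of all `t + v`, where `v` runs over the nonzero linear forms
in `S`. -/
def dickson (m i : ℕ) : Sz F m :=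
  (∏ a ∈ Finset.univ.filter (fun a : Fin (m + m) → F => a ≠ 0),
    (Polynomial.X + Polynomial.C (∑ j, C (a j) * w F m j))).coeff
      (Fintype.card F ^ (2 * m - i) - 1)

/-- The sum of the natural monomials in the indeterminates `X 1, …, X i` (with `X ℓ` of degree
`q^ℓ + 1`) of degree `d` and natural degree `n`. A monomial is natural if the base `q` digits of
its exponents are `0` or `1`; so it is the product of the natural factors `X ℓ ^ (q ^ r)`,
`(ℓ, r) ∈ T`, for a unique finite set `T`, and the natural degree is the cardinality of `T`.
(The degree forces `r ≤ d`.) -/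
def natSum (i d n : ℕ) : MvPolynomial ℕ F :=
  ∑ T ∈ ((Finset.Icc 1 i ×ˢ Finset.range (d + 1)).powersetCard n).filter
      (fun T => ∑ p ∈ T, (Fintype.card F ^ p.1 + 1) * Fintype.card F ^ p.2 = d),
    ∏ p ∈ T, X p.1 ^ Fintype.card F ^ p.2

/-- The polynomial expressing `u_{m-1}` in terms of `ξ₁, …, ξ_{2m-3}`. -/
def uPrevPoly (m : ℕ) : MvPolynomial ℕ F :=
  natSum F (2 * m - 3) (∑ l ∈ Finset.range (2 * m - 2), Fintype.card F ^ l) (m - 1)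

/-- `u_{m-1}` interpreted as an element of `S_m`. -/
def uPrev (m : ℕ) : Sz F m := aeval (xi F m) (uPrevPoly F m)

/-- `δ_{jk}`: the sum of the natural monomials in `ξ₁, …, ξ_{2m-2}` of degree
`q + q² + ⋯ + q^(2m-2) - q^j - q^k` and natural degree `m - 2`. -/
def deltaPair (m j k : ℕ) : Sz F m :=
  aeval (xi F m) (natSum F (2 * m - 2)
    (∑ l ∈ ((Finset.Icc 1 (2 * m - 2)).erase j).erase k, Fintype.card F ^ l) (m - 2))

/-- `δ₁ = ∑_{0 < j < k < 2m-1} ξ_j ξ_k δ_{jk}`. -/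
def deltaOne (m : ℕ) : Sz F m :=
  ∑ k ∈ Finset.Ico 1 (2 * m - 1), ∑ j ∈ Finset.Ico 1 k, xi F m j * xi F m k * deltaPair F m j k

/-- The polynomial whose square root is `b₁`. -/
def bOneSq (m : ℕ) : Sz F m :=
  dickson F m 1 + u F m ^ (Fintype.card F - 2) *
    (deltaOne F m + xiBar F m * uPrev F m ^ Fintype.card F)

variable {F}

/-- `eInv m b k` is the invariant `e_{k+1}`, where `b` is the square root `b₁` of `bOneSq`:
`e₁ = u_m^(q/2-1) u_{m-1}^(q/2) z + b₁` and `e_{i+1} = P^(q^(2m-1-i)/2) e_i`. -/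
def eInv (m : ℕ) (b : Sz F m) : ℕ → Sz F m
  | 0 => u F m ^ (Fintype.card F / 2 - 1) * uPrev F m ^ (Fintype.card F / 2) * z F m + b
  | k + 1 => steenrod F m (Fintype.card F ^ (2 * m - 1 - (k + 1)) / 2) (eInv m b k)

/-- The family `ξ₀, ξ₁, …, ξ_m, e₁, …, e_m`. -/
def hFamily (m : ℕ) (b : Sz F m) : Fin (m + 1) ⊕ Fin m → Sz F m :=
  Sum.elim (fun i => xi F m i) (fun i => eInv m b i)

end OddOrth

end

noncomputable section

open MvPolynomial

namespace OddOrth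

/-! ### Parameter criterion: a trivial common zero set gives a system of parameters. -/

section Parameters

variable {F K σ ι : Type*} [Field F]

/-! Let `w` be the vector of the `2m` variables other than `z`, and `form` the alternating form
pairing `x_j` with `y_j`. The Gram entries of the Frobenius twists `w^(q^k)` are `ξ_(l-k)^(q^k)`. A
sum of natural monomials of the prescribed degree and natural degree is a signless Pfaffian of such
entries: a natural factor is an edge between two twists, and uniqueness of the shortest expansion in
powers of `q` forces the edges to form a perfect matching (`aeval_natSum_eq_pf`). In characteristic
2 the Pfaffian of the Gram matrix of `2m` vectors is their determinant (`pf_form_eq_det`). For the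
twists this is the Moore determinant, which factors into orbit products; this gives claim 1.

Over a perfect field of characteristic 2 a polynomial is a square as soon as all its partial
derivatives vanish. A derivation `D` sends `d_{1,m}` to `u_m^(q-2)` times the determinant with rows
`w, Dw, w^q, w^(q^2), …`. It sends `δ₁ + ξ̄₀ u_{m-1}^q` to the Pfaffian expansion of the same
determinant along its first two rows. The two contributions cancel (`derivation_bOneSq`), which
gives `b₁`; squaring is injective, so `b₁` is unique.

Squaring turns `P^k` into `P^(2k)`, the operations `P^(q^(2m-1-i))` carry `d_{i,m}` to `d_{i+1,m}`,
and the ideal of all `ξ_k` is stable under Steenrod operations. Hence `e_i²` is congruent to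
`d_{i,m}` modulo that ideal (`eInv_sq_sub_dickson_mem`). Invariance passes from `ξ₀` to every `ξ_k`
because Steenrod operations commute with substitutions; Dickson invariants are fixed because the
orthogonal group preserves the span of `w`; `e₁` inherits invariance from its square.

At a common zero the twists `0, …, m` of the coordinate vector are mutually orthogonal, hence
dependent, because an isotropic subspace has dimension at most `m`. The relation confines all twists
to their span, so every `ξ_k` vanishes, and with them `d_{1,m}, …, d_{m,m}`. The relation also
bounds by `m` the dimension of the `F`-span of the coordinates, and then the lowest coefficient of
`∏ (X + v)` forces the point to be the origin (`eq_zero_of_dicksonPoly_coeff`). The Nullstellensatz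
turns this into finiteness, and the count `2m+1` yields algebraic independence. -/

theorem homogeneousComponent_mul_isHomogeneous (h : MvPolynomial σ F) {f : MvPolynomial σ F}
    {k : ℕ} (hf : f.IsHomogeneous k) (n : ℕ) :
    homogeneousComponent n (h * f) =
      ∑ e ∈ Finset.range (h.totalDegree + 1),
        if e + k = n then homogeneousComponent e h * f else 0 := by
  conv_lhs => rw [← sum_homogeneousComponent h, Finset.sum_mul, map_sum]
  refine Finset.sum_congr rfl fun e _ => ?_
  rw [homogeneousComponent_of_mem ((homogeneousComponent_isHomogeneous e h).mul hf)]
  simp only [eq_comm]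

/-- A finite family of homogeneous polynomials of positive degree whose only common zero over an
algebraically closed extension is the origin makes the polynomial ring a finite module. -/
theorem aeval_finite_of_forall_zero [Field K] [Algebra F K] [IsAlgClosed K] [Finite σ] [Finite ι]
    (f : ι → MvPolynomial σ F) (hf : ∀ i, ∃ d : ℕ, 0 < d ∧ (f i).IsHomogeneous d)
    (hz : ∀ v : σ → K, (∀ i, aeval v (f i) = 0) → v = 0) :
    (aeval f : MvPolynomial ι F →ₐ[F] MvPolynomial σ F).Finite := by
  classical
  have := Fintype.ofFinite ι
  have := Fintype.ofFinite σ
  choose d hd hf using hf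
  -- Nullstellensatz: each variable vanishes on the zero set, so it lies in the radical.
  have hX : ∀ s : σ, ∃ N : ℕ, (X s : MvPolynomial σ F) ^ N ∈ Ideal.span (Set.range f) := by
    intro s
    have : (X s : MvPolynomial σ F) ∈ (Ideal.span (Set.range f)).radical := by
      rw [← vanishingIdeal_zeroLocus_eq_radical (K := K)]
      intro v hv
      have : v = 0 := hz v fun i => hv _ (Ideal.subset_span ⟨i, rfl⟩)
      simp [this]
    exact this
  choose N hN using hX
  let A : Algebra (MvPolynomial ι F) (MvPolynomial σ F) :=
    (aeval f : MvPolynomial ι F →ₐ[F] MvPolynomial σ F).toRingHom.toAlgebra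
  have hsmul : ∀ (c : MvPolynomial ι F) (p : MvPolynomial σ F), c • p = aeval f c * p :=
    fun c p => rfl
  let B : Set (MvPolynomial σ F) :=
    (fun a : σ →₀ ℕ => monomial a (1 : F)) '' {a | ∀ s, a s ≤ N s}
  have hB : B.Finite := by
    apply Set.Finite.image
    refine (Set.finite_Iic (Finsupp.equivFunOnFinite.symm N)).subset fun a ha => ?_
    intro s
    simpa using ha s
  let M := Submodule.span (MvPolynomial ι F) B
  have hC : ∀ (r : F) (p : MvPolynomial σ F), p ∈ M → C r * p ∈ M := by
    intro r p hp
    have := M.smul_mem (C r) hp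
    rwa [hsmul, aeval_C] at this
  have hF : ∀ (i : ι) (p : MvPolynomial σ F), p ∈ M → p * f i ∈ M := by
    intro i p hp
    have := M.smul_mem (X i) hp
    rwa [hsmul, aeval_X, mul_comm] at this
  -- Graded Nakayama: a monomial outside the box `B` lies in the ideal, and the degree `n` part of
  -- its representation has coefficients of smaller degree, since each `f i` has positive degree.
  have key : ∀ (n : ℕ) (p : MvPolynomial σ F), p.IsHomogeneous n → p ∈ M := by
    intro n
    induction n using Nat.strong_induction_on with
    | _ n ih =>
      intro p hp
      rw [p.as_sum]
      refine Submodule.sum_mem _ fun a ha => ?_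
      have hdeg : a.degree = n := by
        by_contra h
        exact (mem_support_iff.1 ha) (hp.coeff_eq_zero h)
      rw [← mul_one (coeff a p), ← C_mul_monomial]
      apply hC
      by_cases hs : ∀ s, a s ≤ N s
      · exact Submodule.subset_span ⟨a, hs, rfl⟩
      · push Not at hs
        obtain ⟨s, hs⟩ := hs
        have hmem : monomial a (1 : F) ∈ Ideal.span (Set.range f) := by
          have : monomial a (1 : F) = monomial (a - Finsupp.single s (N s)) 1 * X s ^ N s := by
            rw [X_pow_eq_monomial, monomial_mul, tsub_add_cancel_of_le, one_mul]
            simpa using hs.le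
          rw [this]
          exact Ideal.mul_mem_left _ _ (hN s)
        obtain ⟨h, hh⟩ := (Ideal.mem_span_range_iff_exists_fun).1 hmem
        have h1 : monomial a (1 : F) = ∑ i, homogeneousComponent n (h i * f i) := by
          rw [← map_sum, hh, homogeneousComponent_eq_self]
          exact isHomogeneous_monomial _ hdeg
        rw [h1]
        refine Submodule.sum_mem _ fun i _ => ?_
        rw [homogeneousComponent_mul_isHomogeneous _ (hf i)]
        refine Submodule.sum_mem _ fun e _ => ?_
        split_ifs with he
        · exact hF i _ (ih e (by have := hd i; omega) _ (homogeneousComponent_isHomogeneous e _))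
        · exact M.zero_mem
  refine ⟨⟨hB.toFinset, ?_⟩⟩
  rw [eq_top_iff]
  intro p _
  rw [Set.Finite.coe_toFinset, ← sum_homogeneousComponent p]
  exact Submodule.sum_mem _ fun e _ => key e _ (homogeneousComponent_isHomogeneous e _)

/-- Finiteness makes the polynomial ring algebraic over `F[f]`; a family with this property whose
size is the transcendence degree is a transcendence basis. -/
theorem algebraicIndependent_of_aeval_finite [Finite σ] [Finite ι]
    (hcard : Nat.card ι = Nat.card σ) (f : ι → MvPolynomial σ F)
    (hfin : (aeval f : MvPolynomial ι F →ₐ[F] MvPolynomial σ F).Finite) :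
    AlgebraicIndependent F f := by
  have hint : ∀ p : MvPolynomial σ F, IsIntegral (Algebra.adjoin F (Set.range f)) p := by
    intro p
    have h := hfin.to_isIntegral p
    obtain ⟨P, hP, hPe⟩ := h
    have hmem : ∀ c : MvPolynomial ι F, aeval f c ∈ Algebra.adjoin F (Set.range f) := by
      intro c
      rw [Algebra.adjoin_range_eq_range_aeval]
      exact ⟨c, rfl⟩
    let g : MvPolynomial ι F →+* Algebra.adjoin F (Set.range f) :=
      ((aeval f).codRestrict _ hmem).toRingHom
    refine ⟨P.map g, hP.map g, ?_⟩
    rw [Polynomial.eval₂_map]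
    exact hPe
  have : Algebra.IsAlgebraic (Algebra.adjoin F (Set.range f)) (MvPolynomial σ F) :=
    ⟨fun p => (hint p).isAlgebraic⟩
  refine (Algebra.IsAlgebraic.isTranscendenceBasis_of_lift_le_trdeg_of_finite F f ?_).1
  rw [MvPolynomial.trdeg_of_isDomain]
  have h2 : Cardinal.mk ι = (Nat.card ι : Cardinal) := Nat.cast_card.symm
  have h3 : Cardinal.mk σ = (Nat.card σ : Cardinal) := Nat.cast_card.symm
  simp [h2, h3, hcard]

theorem isHSOP_of_forall_zero [Field K] [Algebra F K] [IsAlgClosed K] [Finite σ] [Finite ι]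
    (hcard : Nat.card ι = Nat.card σ) (A : Subalgebra F (MvPolynomial σ F))
    (f : ι → MvPolynomial σ F) (hA : ∀ i, f i ∈ A)
    (hf : ∀ i, ∃ d : ℕ, 0 < d ∧ (f i).IsHomogeneous d)
    (hz : ∀ v : σ → K, (∀ i, aeval v (f i) = 0) → v = 0) : IsHSOP A f := by
  have hfin := aeval_finite_of_forall_zero f hf hz
  refine ⟨hA, hf, algebraicIndependent_of_aeval_finite hcard f hfin, ?_⟩
  let g := (aeval (fun i => (⟨f i, hA i⟩ : A)) : MvPolynomial ι F →ₐ[F] A)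
  have hg : A.val.comp g = aeval f := by
    apply MvPolynomial.algHom_ext
    intro i
    simp [g]
  let _ : Algebra (MvPolynomial ι F) (MvPolynomial σ F) :=
    (aeval f : MvPolynomial ι F →ₐ[F] MvPolynomial σ F).toRingHom.toAlgebra
  let _ : Algebra (MvPolynomial ι F) A := g.toRingHom.toAlgebra
  have : Module.Finite (MvPolynomial ι F) (MvPolynomial σ F) := hfin
  let l : A →ₗ[MvPolynomial ι F] MvPolynomial σ F :=
    { toFun := A.val
      map_add' := fun a b => rfl
      map_smul' := fun c a => by
        change A.val (g c * a) = aeval f c * A.val a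
        rw [map_mul, ← hg]
        rfl }
  -- The invariants form a submodule of a finite module over a Noetherian ring.
  exact Module.Finite.of_injective l Subtype.val_injective

end Parameters

/-! ### Squares of polynomials in characteristic 2. -/

section SquareRoots

variable {F σ : Type*} [Field F] [CharP F 2]

/-- Squaring doubles all exponents and applies Frobenius to the coefficients. -/
theorem coeff_two_smul_sq (f : MvPolynomial σ F) (a : σ →₀ ℕ) :
    coeff (2 • a) (f ^ 2) = coeff a f ^ 2 := by
  have : ExpChar F 2 := ExpChar.prime Nat.prime_two
  have h : f ^ 2 = map (frobenius F 2) (expand 2 f) := by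
    induction f using MvPolynomial.induction_on with
    | C r => simp [frobenius_def]
    | add p q hp hq => rw [CharTwo.add_sq, hp, hq, map_add, map_add]
    | mul_X p i hp => rw [mul_pow, hp, map_mul, map_mul]; simp
  rw [h, coeff_map, coeff_expand_smul 2 two_ne_zero, frobenius_def]

theorem isHomogeneous_of_sq {f : MvPolynomial σ F} {d : ℕ} (h : (f ^ 2).IsHomogeneous (2 * d)) :
    f.IsHomogeneous d := by
  intro a ha
  have h1 : coeff (2 • a) (f ^ 2) ≠ 0 := by
    rw [coeff_two_smul_sq]
    exact pow_ne_zero 2 ha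
  have h2 := h h1
  rw [map_nsmul] at h2
  simpa using h2

/-- The coefficients of `∂_i f` are those of `f` multiplied by the exponents of the `i`-th variable,
so all exponents occurring in `f` are even. Coefficients have square roots, and squaring is
additive, so `f` has a root term by term. -/
theorem exists_sq_eq_of_pderiv_eq_zero [PerfectRing F 2] (f : MvPolynomial σ F)
    (hf : ∀ i, pderiv i f = 0) : ∃ g, g ^ 2 = f := by
  classical
  have hev : ∀ a ∈ f.support, ∃ b : σ →₀ ℕ, a = 2 • b := by
    intro a ha
    have hdvd : ∀ i, 2 ∣ a i := by
      intro i
      by_contra hi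
      have h1 : Finsupp.single i 1 ≤ a := by
        rw [Finsupp.single_le_iff]
        omega
      have h2 := coeff_pderiv (i := i) f (a - Finsupp.single i 1)
      rw [hf i, coeff_zero, tsub_add_cancel_of_le h1] at h2
      have h3 : ((a - Finsupp.single i 1 : σ →₀ ℕ) i + 1 : ℕ) = a i := by
        simp
        omega
      rw [← Nat.cast_add_one, h3] at h2
      rcases mul_eq_zero.1 h2.symm with h4 | h4
      · exact (mem_support_iff.1 ha) h4
      · exact hi ((CharP.cast_eq_zero_iff F 2 _).1 h4)
    refine ⟨a.mapRange (· / 2) (by simp), ?_⟩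
    ext i
    have := hdvd i
    simp
    omega
  have hsum : ∀ s ⊆ f.support, ∃ g, g ^ 2 = ∑ a ∈ s, monomial a (coeff a f) := by
    intro s
    induction s using Finset.induction_on with
    | empty => exact fun _ => ⟨0, by simp⟩
    | insert a s has ih =>
      intro hs
      obtain ⟨g, hg⟩ := ih fun b hb => hs (Finset.mem_insert_of_mem hb)
      obtain ⟨b, hb⟩ := hev a (hs (Finset.mem_insert_self a s))
      obtain ⟨c, hc⟩ := surjective_frobenius F 2 (coeff a f)
      refine ⟨monomial b c + g, ?_⟩
      rw [CharTwo.add_sq, hg, Finset.sum_insert has, monomial_pow, ← hb]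
      rw [frobenius_def] at hc
      rw [hc]
  obtain ⟨g, hg⟩ := hsum f.support subset_rfl
  exact ⟨g, by rw [hg, ← f.as_sum]⟩

end SquareRoots

/-! ### Signless Pfaffians and determinants of Gram matrices. -/

section Pfaffian

variable {R : Type*} [CommRing R]

/-- `T` is a perfect matching of `I`, each edge being listed with its smaller end first. -/
def IsMatching (I : Finset ℕ) (T : Finset (ℕ × ℕ)) : Prop :=
  (∀ p ∈ T, p.1 < p.2) ∧ ∑ p ∈ T, ({p.1, p.2} : Multiset ℕ) = I.val

open Classical in
/-- The Pfaffian (without signs) of the array `a` over the index set `I`. -/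
def pf (a : ℕ → ℕ → R) (I : Finset ℕ) : R :=
  ∑ T ∈ (I ×ˢ I).powerset.filter (IsMatching I), ∏ p ∈ T, a p.1 p.2

theorem IsMatching.mem {I : Finset ℕ} {T : Finset (ℕ × ℕ)} (h : IsMatching I T) {p : ℕ × ℕ}
    (hp : p ∈ T) : p.1 ∈ I ∧ p.2 ∈ I := by
  have hle : ({p.1, p.2} : Multiset ℕ) ≤ I.val := by
    rw [← h.2]
    exact Finset.single_le_sum (f := fun p : ℕ × ℕ => ({p.1, p.2} : Multiset ℕ))
      (fun _ _ => Multiset.zero_le _) hp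
  exact ⟨Multiset.mem_of_le hle (by simp), Multiset.mem_of_le hle (by simp)⟩

theorem IsMatching.mem_powerset {I : Finset ℕ} {T : Finset (ℕ × ℕ)} (h : IsMatching I T) :
    T ∈ (I ×ˢ I).powerset := by
  rw [Finset.mem_powerset]
  intro p hp
  exact Finset.mem_product.2 (h.mem hp)

@[simp]
theorem pf_empty (a : ℕ → ℕ → R) : pf a ∅ = 1 := by
  classical
  have h : ((∅ ×ˢ ∅ : Finset (ℕ × ℕ)).powerset.filter (IsMatching ∅)) = {∅} := by
    ext T
    simp only [Finset.product_empty, Finset.powerset_empty, Finset.mem_filter,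
      Finset.mem_singleton, and_iff_left_iff_imp]
    rintro rfl
    exact ⟨by simp, by simp⟩
  rw [pf, h]
  simp

/-- Expansion of the Pfaffian along its first row. -/
theorem pf_insert (a : ℕ → ℕ → R) {i : ℕ} {J : Finset ℕ} (hi : ∀ j ∈ J, i < j) :
    pf a (insert i J) = ∑ k ∈ J, a i k * pf a (J.erase k) := by
  classical
  have hiJ : i ∉ J := fun h => lt_irrefl _ (hi i h)
  have hins : ∀ k ∈ J, (insert i J).val = ({i, k} : Multiset ℕ) + (J.erase k).val := by
    intro k hk
    rw [Finset.insert_val_of_notMem hiJ, Finset.erase_val, Multiset.insert_eq_cons,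
      Multiset.cons_add, Multiset.singleton_add, Multiset.cons_erase hk]
  have hnot : ∀ (k k' : ℕ) (T : Finset (ℕ × ℕ)), IsMatching (J.erase k) T → (i, k') ∉ T :=
    fun k k' T hT h => hiJ (Finset.mem_of_mem_erase (hT.mem h).1)
  symm
  simp only [pf, Finset.mul_sum]
  rw [Finset.sum_sigma']
  refine Finset.sum_bij (fun x _ => insert (i, x.1) x.2) ?_ ?_ ?_ ?_
  · rintro ⟨k, T⟩ h
    simp only [Finset.mem_sigma, Finset.mem_filter] at h ⊢
    obtain ⟨hk, -, hT⟩ := h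
    have : IsMatching (insert i J) (insert (i, k) T) := by
      refine ⟨?_, ?_⟩
      · intro p hp
        rcases Finset.mem_insert.1 hp with rfl | hp
        · exact hi k hk
        · exact hT.1 p hp
      · rw [Finset.sum_insert (hnot k k T hT), hT.2, hins k hk]
    exact ⟨this.mem_powerset, this⟩
  · rintro ⟨k, T⟩ h ⟨k', T'⟩ h' heq
    simp only [Finset.mem_sigma, Finset.mem_filter] at h h'
    dsimp only at heq
    have h1 : (i, k) ∈ insert (i, k') T' := heq ▸ Finset.mem_insert_self _ _
    rcases Finset.mem_insert.1 h1 with h2 | h2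
    · obtain rfl : k = k' := (Prod.mk.inj h2).2
      congr 1
      rw [← Finset.erase_insert (hnot k k T h.2.2), heq,
        Finset.erase_insert (hnot k k T' h'.2.2)]
    · exact absurd h2 (hnot k' k T' h'.2.2)
  · intro T hT
    simp only [Finset.mem_filter] at hT
    obtain ⟨-, hT⟩ := hT
    have hmem : i ∈ ∑ p ∈ T, ({p.1, p.2} : Multiset ℕ) := by
      rw [hT.2]
      exact Finset.mem_insert_self i J
    obtain ⟨p, hp, hip⟩ := Multiset.mem_sum.1 hmem
    have hpI := hT.mem hp
    have hlt := hT.1 p hp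
    have hp1 : p.1 = i := by
      by_contra hne
      have hp1J := (Finset.mem_insert.1 hpI.1).resolve_left hne
      have := hi _ hp1J
      simp only [Multiset.insert_eq_cons, Multiset.mem_cons, Multiset.mem_singleton] at hip
      omega
    have hp2 : p.2 ∈ J := (Finset.mem_insert.1 hpI.2).resolve_left (by omega)
    have hpe : p = (i, p.2) := Prod.ext hp1 rfl
    have hM : IsMatching (J.erase p.2) (T.erase p) := by
      refine ⟨fun r hr => hT.1 r (Finset.mem_of_mem_erase hr), ?_⟩
      have h1 := Finset.add_sum_erase T (fun p : ℕ × ℕ => ({p.1, p.2} : Multiset ℕ)) hp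
      rw [hT.2, hins p.2 hp2] at h1
      simp only [hp1] at h1
      exact add_left_cancel h1
    refine ⟨⟨p.2, T.erase p⟩, ?_, ?_⟩
    · simp only [Finset.mem_sigma, Finset.mem_filter]
      exact ⟨hp2, hM.mem_powerset, hM⟩
    · dsimp only
      rw [← hpe, Finset.insert_erase hp]
  · rintro ⟨k, T⟩ h
    simp only [Finset.mem_sigma, Finset.mem_filter] at h
    dsimp only
    rw [Finset.prod_insert (hnot k k T h.2.2)]

theorem map_pf {S : Type*} [CommRing S] (f : R →+* S) (a : ℕ → ℕ → R) (I : Finset ℕ) :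
    f (pf a I) = pf (fun i j => f (a i j)) I := by
  simp only [pf, map_sum, map_prod]

theorem pf_congr {a b : ℕ → ℕ → R} {I : Finset ℕ}
    (h : ∀ i ∈ I, ∀ j ∈ I, i < j → a i j = b i j) : pf a I = pf b I := by
  classical
  refine Finset.sum_congr rfl fun T hT => Finset.prod_congr rfl fun p hp => ?_
  have hM := (Finset.mem_filter.1 hT).2
  exact h _ (hM.mem hp).1 _ (hM.mem hp).2 (hM.1 p hp)

/-- The Pfaffian depends only on the order type of the index set. -/
theorem pf_map (a : ℕ → ℕ → R) (g : ℕ ↪o ℕ) (I : Finset ℕ) :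
    pf a (I.map g.toEmbedding) = pf (fun i j => a (g i) (g j)) I := by
  induction hn : I.card using Nat.strong_induction_on generalizing I with
  | _ n ih =>
    rcases I.eq_empty_or_nonempty with rfl | hI
    · simp
    · have hmin : insert (I.min' hI) (I.erase (I.min' hI)) = I :=
        Finset.insert_erase (Finset.min'_mem I hI)
      have hlt : ∀ j ∈ I.erase (I.min' hI), I.min' hI < j := fun j hj =>
        lt_of_le_of_ne (Finset.min'_le _ _ (Finset.mem_of_mem_erase hj))
          (Finset.ne_of_mem_erase hj).symm
      have hcard : (I.erase (I.min' hI)).card < n := by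
        rw [← hn]
        exact Finset.card_erase_lt_of_mem (Finset.min'_mem I hI)
      generalize I.min' hI = i at *
      generalize I.erase i = J at *
      subst hmin
      rw [Finset.map_insert, pf_insert _ (by simpa using hlt), pf_insert _ hlt, Finset.sum_map]
      refine Finset.sum_congr rfl fun k hk => ?_
      have h1 : (J.map g.toEmbedding).erase (g.toEmbedding k) = (J.erase k).map g.toEmbedding :=
        (Finset.map_erase _ _ _).symm
      rw [h1, ih _ ((Finset.card_erase_lt_of_mem hk).trans hcard) _ rfl]
      rfl

variable {N : ℕ}

/-- The involutions of `Fin N` whose set of non-fixed points is `I`. -/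
def involutions (I : Finset (Fin N)) : Finset (Equiv.Perm (Fin N)) :=
  Finset.univ.filter fun σ => σ * σ = 1 ∧ σ.support = I

/-- An involution moving `i` to `k` is the transposition of `i` and `k` times an involution with the
remaining support. This is the recursion of `pf_insert`, for permutations in place of matchings. -/
theorem sum_involutions_insert (A : Fin N → Fin N → R) {i : Fin N} {J : Finset (Fin N)}
    (hi : ∀ j ∈ J, i < j) :
    ∑ σ ∈ involutions (insert i J), ∏ l ∈ Finset.univ.filter (fun l => l < σ l), A l (σ l) =
      ∑ k ∈ J, A i k * ∑ σ ∈ involutions (J.erase k),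
        ∏ l ∈ Finset.univ.filter (fun l => l < σ l), A l (σ l) := by
  have hiJ : i ∉ J := fun h => lt_irrefl _ (hi i h)
  have hdisj : ∀ k, ∀ σ ∈ involutions (J.erase k), σ i = i ∧ σ k = k := by
    intro k σ hσ
    have hσ := (Finset.mem_filter.1 hσ).2.2
    constructor
    · rw [← Equiv.Perm.notMem_support, hσ]
      exact fun h => hiJ (Finset.mem_of_mem_erase h)
    · rw [← Equiv.Perm.notMem_support, hσ]
      exact Finset.notMem_erase k J
  symm
  simp only [Finset.mul_sum]
  rw [Finset.sum_sigma']
  refine Finset.sum_bij (fun x _ => Equiv.swap i x.1 * x.2) ?_ ?_ ?_ ?_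
  · rintro ⟨k, σ⟩ h
    simp only [Finset.mem_sigma] at h
    obtain ⟨hk, hσ⟩ := h
    obtain ⟨h1, h2⟩ := hdisj k σ hσ
    have hik : i ≠ k := (hi k hk).ne
    simp only [involutions, Finset.mem_filter, Finset.mem_univ, true_and] at hσ ⊢
    have hd : Equiv.Perm.Disjoint (Equiv.swap i k) σ := by
      intro l
      by_cases hl : l = i
      · right; rw [hl, h1]
      · by_cases hl' : l = k
        · right; rw [hl', h2]
        · left; exact Equiv.swap_apply_of_ne_of_ne hl hl'
    refine ⟨?_, ?_⟩
    · rw [mul_assoc, ← mul_assoc σ, ← hd.commute.eq, mul_assoc, hσ.1, mul_one,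
        Equiv.swap_mul_self]
    · rw [hd.support_mul, Equiv.Perm.support_swap hik, hσ.2]
      ext l
      simp only [Finset.mem_union, Finset.mem_insert, Finset.mem_singleton, Finset.mem_erase]
      grind
  · rintro ⟨k, σ⟩ h ⟨k', σ'⟩ h' heq
    simp only [Finset.mem_sigma] at h h'
    dsimp only at heq
    have e1 := congrArg (fun τ : Equiv.Perm (Fin N) => τ i) heq
    simp only [Equiv.Perm.mul_apply, (hdisj k σ h.2).1, (hdisj k' σ' h'.2).1,
      Equiv.swap_apply_left] at e1
    subst e1
    congr 1
    exact mul_left_cancel heq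
  · intro τ hτ
    simp only [involutions, Finset.mem_filter, Finset.mem_univ, true_and] at hτ
    have hinv : ∀ l, τ (τ l) = l := fun l => by
      rw [← Equiv.Perm.mul_apply, hτ.1, Equiv.Perm.one_apply]
    have hmv : ∀ l, τ l ≠ l ↔ l ∈ insert i J := fun l => by
      rw [← hτ.2, Equiv.Perm.mem_support]
    have hki : τ i ≠ i := (hmv i).2 (Finset.mem_insert_self _ _)
    have hkJ : τ i ∈ J := by
      refine (Finset.mem_insert.1 ((hmv (τ i)).1 ?_)).resolve_left hki
      rw [hinv]
      exact hki.symm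
    refine ⟨⟨τ i, Equiv.swap i (τ i) * τ⟩, ?_, ?_⟩
    · have hval : ∀ l, l ≠ i → l ≠ τ i → (Equiv.swap i (τ i) * τ) l = τ l := by
        intro l h1 h2
        rw [Equiv.Perm.mul_apply, Equiv.swap_apply_of_ne_of_ne]
        · exact fun h => h2 (by rw [← h, hinv])
        · exact fun h => h1 (τ.injective h)
      have hvi : (Equiv.swap i (τ i) * τ) i = i := by
        rw [Equiv.Perm.mul_apply, Equiv.swap_apply_right]
      have hvk : (Equiv.swap i (τ i) * τ) (τ i) = τ i := by
        rw [Equiv.Perm.mul_apply, hinv, Equiv.swap_apply_left]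
      simp only [Finset.mem_sigma, involutions, Finset.mem_filter, Finset.mem_univ, true_and]
      refine ⟨hkJ, ?_, ?_⟩
      · ext1 l
        rw [Equiv.Perm.mul_apply, Equiv.Perm.one_apply]
        by_cases h1 : l = i
        · rw [h1, hvi, hvi]
        · by_cases h2 : l = τ i
          · rw [h2, hvk, hvk]
          · rw [hval l h1 h2, hval (τ l), hinv]
            · exact fun h => h2 (by rw [← h, hinv])
            · exact fun h => h1 (τ.injective h)
      · ext l
        rw [Equiv.Perm.mem_support, Finset.mem_erase]
        by_cases h1 : l = i
        · rw [h1, hvi]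
          simp [hiJ]
        · by_cases h2 : l = τ i
          · rw [h2, hvk]
            simp
          · rw [hval l h1 h2, hmv, Finset.mem_insert]
            simp [h1, h2]
    · dsimp only
      rw [← mul_assoc, Equiv.swap_mul_self, one_mul]
  · rintro ⟨k, σ⟩ h
    simp only [Finset.mem_sigma] at h
    obtain ⟨hk, hσ⟩ := h
    obtain ⟨h1, h2⟩ := hdisj k σ hσ
    have hik : i < k := hi k hk
    dsimp only
    have hσinj : ∀ l, l ≠ i → l ≠ k → (Equiv.swap i k * σ) l = σ l := by
      intro l hl hl'
      rw [Equiv.Perm.mul_apply, Equiv.swap_apply_of_ne_of_ne]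
      · exact fun h => hl (σ.injective (h.trans h1.symm))
      · exact fun h => hl' (σ.injective (h.trans h2.symm))
    have hvi : (Equiv.swap i k * σ) i = k := by
      rw [Equiv.Perm.mul_apply, h1, Equiv.swap_apply_left]
    have hvk : (Equiv.swap i k * σ) k = i := by
      rw [Equiv.Perm.mul_apply, h2, Equiv.swap_apply_right]
    have hset : Finset.univ.filter (fun l => l < (Equiv.swap i k * σ) l) =
        insert i (Finset.univ.filter fun l => l < σ l) := by
      ext l
      simp only [Finset.mem_filter, Finset.mem_univ, true_and, Finset.mem_insert]
      by_cases hl : l = i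
      · rw [hl, hvi]
        simp [hik]
      · by_cases hl' : l = k
        · rw [hl', hvk, h2]
          simp [hik.ne', hik.le]
        · rw [hσinj l hl hl']
          simp [hl]
    rw [hset, Finset.prod_insert (by simp [h1]), hvi]
    congr 1
    refine Finset.prod_congr rfl fun l hl => ?_
    have hl := (Finset.mem_filter.1 hl).2
    rw [hσinj l (fun h => by rw [h, h1] at hl; exact lt_irrefl _ hl)
      (fun h => by rw [h, h2] at hl; exact lt_irrefl _ hl)]

theorem sum_involutions_eq_pf (a : ℕ → ℕ → R) (I : Finset (Fin N)) :
    ∑ σ ∈ involutions I, ∏ l ∈ Finset.univ.filter (fun l => l < σ l), a l (σ l) =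
      pf a (I.map Fin.valEmbedding) := by
  induction hn : I.card using Nat.strong_induction_on generalizing I with
  | _ n ih =>
    rcases I.eq_empty_or_nonempty with rfl | hI
    · have h : involutions (∅ : Finset (Fin N)) = {1} := by
        ext σ
        simp only [involutions, Finset.mem_filter, Finset.mem_univ, true_and,
          Equiv.Perm.support_eq_empty_iff, Finset.mem_singleton]
        constructor
        · exact fun h => h.2
        · rintro rfl
          exact ⟨one_mul 1, rfl⟩
      rw [h]
      simp
    · have hmin : insert (I.min' hI) (I.erase (I.min' hI)) = I :=
        Finset.insert_erase (Finset.min'_mem I hI)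
      have hlt : ∀ j ∈ I.erase (I.min' hI), I.min' hI < j := fun j hj =>
        lt_of_le_of_ne (Finset.min'_le _ _ (Finset.mem_of_mem_erase hj))
          (Finset.ne_of_mem_erase hj).symm
      have hcard : (I.erase (I.min' hI)).card < n := by
        rw [← hn]
        exact Finset.card_erase_lt_of_mem (Finset.min'_mem I hI)
      generalize I.min' hI = i at *
      generalize I.erase i = J at *
      subst hmin
      rw [Finset.map_insert, pf_insert _ (by simpa using hlt),
        sum_involutions_insert (fun l k => a l k) hlt, Finset.sum_map]
      refine Finset.sum_congr rfl fun k hk => ?_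
      rw [← Finset.map_erase, ih _ ((Finset.card_erase_lt_of_mem hk).trans hcard) _ rfl]
      rfl

/-- Signs disappear in the Leibniz formula. By symmetry `σ` and `σ⁻¹` contribute equally and cancel
unless `σ` is an involution, and a fixed point contributes a zero diagonal entry. Each
fixed-point-free involution uses every entry twice, and a sum of squares is a square. -/
theorem det_eq_sq_of_symm [CharP R 2] (A : Matrix (Fin N) (Fin N) R) (hs : ∀ i j, A i j = A j i)
    (h0 : ∀ i, A i i = 0) :
    A.det = (∑ σ ∈ involutions (Finset.univ : Finset (Fin N)),
      ∏ l ∈ Finset.univ.filter (fun l => l < σ l), A l (σ l)) ^ 2 := by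
  classical
  have hdet : A.det = ∑ σ : Equiv.Perm (Fin N), ∏ i, A (σ i) i := by
    rw [Matrix.det_apply']
    refine Finset.sum_congr rfl fun σ _ => ?_
    rcases Int.units_eq_one_or (Equiv.Perm.sign σ) with h | h <;> simp [h, CharTwo.neg_eq]
  rw [hdet, ← Finset.sum_filter_add_sum_filter_not Finset.univ
    (fun σ : Equiv.Perm (Fin N) => σ * σ = 1 ∧ σ.support = Finset.univ)]
  have hz : ∑ σ ∈ Finset.univ.filter
      (fun σ : Equiv.Perm (Fin N) => ¬ (σ * σ = 1 ∧ σ.support = Finset.univ)),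
      ∏ i, A (σ i) i = 0 := by
    have hinv : ∀ σ : Equiv.Perm (Fin N), ∏ i, A (σ⁻¹ i) i = ∏ i, A (σ i) i := by
      intro σ
      rw [← Equiv.prod_comp σ]
      refine Finset.prod_congr rfl fun i _ => ?_
      rw [hs]
      simp
    refine Finset.sum_involution (fun σ _ => σ⁻¹) ?_ ?_ ?_ ?_
    · intro σ _
      rw [hinv, CharTwo.add_self_eq_zero]
    · intro σ hσ hne heq
      have hσ := (Finset.mem_filter.1 hσ).2
      have h1 : σ * σ = 1 := by
        nth_rewrite 1 [← heq]
        exact inv_mul_cancel σ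
      apply hσ
      refine ⟨h1, ?_⟩
      ext i
      simp only [Equiv.Perm.mem_support, Finset.mem_univ, iff_true]
      intro hi
      apply hne
      exact Finset.prod_eq_zero (Finset.mem_univ i) (by rw [hi, h0])
    · intro σ hσ
      simp only [Finset.mem_filter, Finset.mem_univ, true_and, Equiv.Perm.support_inv] at hσ ⊢
      rintro ⟨h1, h2⟩
      refine hσ ⟨?_, h2⟩
      rw [← inv_inj, mul_inv_rev, h1, inv_one]
    · intro σ _
      exact inv_inv σ
  rw [hz, add_zero, CharTwo.sum_sq]
  refine Finset.sum_congr (by ext; simp [involutions]) fun σ hσ => ?_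
  replace hσ := (Finset.mem_filter.1 hσ).2
  have hinv : ∀ l, σ (σ l) = l := fun l => by
    rw [← Equiv.Perm.mul_apply, hσ.1, Equiv.Perm.one_apply]
  rw [← Finset.prod_filter_mul_prod_filter_not Finset.univ (fun l => l < σ l), pow_two]
  congr 1
  · exact Finset.prod_congr rfl fun l _ => hs _ _
  -- `σ` exchanges the smaller and the larger ends of its 2-cycles.
  · refine Finset.prod_bij (fun l _ => σ l) ?_ ?_ ?_ ?_
    · intro l hl
      simp only [Finset.mem_filter, Finset.mem_univ, true_and, hinv, not_lt] at hl ⊢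
      refine lt_of_le_of_ne hl ?_
      rw [← Equiv.Perm.mem_support, hσ.2]
      exact Finset.mem_univ l
    · exact fun _ _ _ _ h => σ.injective h
    · intro l hl
      simp only [Finset.mem_filter, Finset.mem_univ, true_and] at hl
      refine ⟨σ l, ?_, hinv l⟩
      simp only [Finset.mem_filter, Finset.mem_univ, true_and, hinv, not_lt]
      exact hl.le
    · intro l _
      rw [hinv]

/-- The alternating bilinear form pairing the coordinates `j` and `rev j`. -/
def form (v v' : Fin N → R) : R := ∑ j, v j * v' j.rev

theorem form_comm (v v' : Fin N → R) : form v v' = form v' v := by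
  unfold form
  rw [← Equiv.sum_comp Fin.revPerm]
  refine Finset.sum_congr rfl fun j _ => ?_
  simp [mul_comm]

/-- The terms at `j` and `rev j` agree and cancel; `rev` has no fixed point because the length is
even. -/
theorem form_self [CharP R 2] {m : ℕ} (v : Fin (m + m) → R) : form v v = 0 := by
  refine Finset.sum_involution (fun j _ => j.rev) ?_ ?_ ?_ ?_
  · intro j _
    rw [Fin.rev_rev, mul_comm (v j.rev), CharTwo.add_self_eq_zero]
  · intro j _ _ h
    have := congrArg Fin.val h
    rw [Fin.val_rev] at this
    omega
  · exact fun _ _ => Finset.mem_univ _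
  · exact fun j _ => Fin.rev_rev j

/-- The Pfaffian of the Gram matrix of `2m` vectors is their determinant. -/
theorem pf_form_eq_det [IsDomain R] [CharP R 2] {m : ℕ} (v : ℕ → Fin (m + m) → R) :
    pf (fun i j => form (v i) (v j)) (Finset.range (m + m)) =
      Matrix.det (Matrix.of fun i j : Fin (m + m) => v i j) := by
  set M : Matrix (Fin (m + m)) (Fin (m + m)) R := Matrix.of fun i j => v i j with hM
  let J : Matrix (Fin (m + m)) (Fin (m + m)) R := Matrix.of fun i j => if i = j.rev then 1 else 0
  have hJJ : J * J = 1 := by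
    ext i j
    simp only [J, Matrix.mul_apply, Matrix.of_apply, Matrix.one_apply]
    rw [Finset.sum_eq_single j.rev]
    · simp
    · intro k _ hk
      simp [hk]
    · simp
  have hJ : J.det ^ 2 = 1 := by rw [pow_two, ← Matrix.det_mul, hJJ, Matrix.det_one]
  -- Since `det J = 1`, the squared Pfaffian is the square of `det M`, and squaring is injective in
  -- a domain of characteristic 2.
  have hG : M * J * M.transpose = Matrix.of fun i j : Fin (m + m) => form (v i) (v j) := by
    ext i j
    simp only [J, hM, Matrix.mul_apply, Matrix.of_apply, Matrix.transpose_apply, form]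
    rw [← Equiv.sum_comp Fin.revPerm]
    refine Finset.sum_congr rfl fun k _ => ?_
    rw [Finset.sum_eq_single k]
    · simp
    · intro l _ hl
      simp [hl]
    · simp
  have hrange : Finset.range (m + m) = (Finset.univ : Finset (Fin (m + m))).map Fin.valEmbedding :=
    (Fin.map_valEmbedding_univ).trans (by ext; simp) |>.symm
  have h1 := det_eq_sq_of_symm (Matrix.of fun i j : Fin (m + m) => form (v i) (v j))
    (fun i j => form_comm _ _) (fun i => form_self _)
  have h2 := sum_involutions_eq_pf (fun i j => form (v i) (v j)) (Finset.univ : Finset (Fin (m + m)))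
  simp only [Matrix.of_apply] at h1
  rw [h2, ← hrange, ← hG, Matrix.det_mul, Matrix.det_mul, Matrix.det_transpose] at h1
  have h3 : J.det = 1 := CharTwo.sq_inj.1 (hJ.trans (one_pow 2).symm)
  rw [h3, mul_one, ← pow_two] at h1
  exact (CharTwo.sq_inj.1 h1).symm

end Pfaffian

/-! ### Sums of natural monomials as Pfaffians. -/

section NaturalMonomials

/-- Trading two copies of `a` for one `a + 1` preserves the sum and shortens the multiset, so the
binary expansion is the unique shortest one. -/
theorem card_le_of_sum_two_pow_eq (s : Multiset ℕ) (I : Finset ℕ)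
    (h : (s.map (2 ^ ·)).sum = ∑ l ∈ I, 2 ^ l) :
    I.card ≤ s.card ∧ (s.card = I.card → s = I.val) := by
  induction hn : s.card using Nat.strong_induction_on generalizing s with
  | _ n ih =>
    by_cases hs : s.Nodup
    · have h1 : (⟨s, hs⟩ : Finset ℕ) = I := Finset.geomSum_injective le_rfl h
      subst h1
      exact ⟨hn.le, fun _ => rfl⟩
    · rw [Multiset.nodup_iff_le] at hs
      push Not at hs
      obtain ⟨a, ha⟩ := hs
      obtain ⟨t, rfl⟩ := Multiset.le_iff_exists_add.1 ha
      have h2 := ih ((a + 1) ::ₘ t).card (by rw [← hn]; simp) ((a + 1) ::ₘ t)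
        (by rw [← h]; simp [pow_succ]; ring) rfl
      have h3 : ((a + 1) ::ₘ t).card < n := by rw [← hn]; simp
      exact ⟨h2.1.trans h3.le, fun h4 => absurd h2.1 (by omega)⟩

theorem eq_of_sum_pow_eq {e : ℕ} (he : 0 < e) (s : Multiset ℕ) (I : Finset ℕ)
    (h : (s.map ((2 ^ e) ^ ·)).sum = ∑ l ∈ I, (2 ^ e) ^ l) (hc : s.card = I.card) : s = I.val := by
  have hinj : Function.Injective (e * · : ℕ → ℕ) := fun a b hab =>
    Nat.eq_of_mul_eq_mul_left he hab
  have h1 := (card_le_of_sum_two_pow_eq (s.map (e * ·)) (I.map ⟨_, hinj⟩) (by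
    rw [Finset.sum_map, Multiset.map_map]
    simpa [pow_mul] using h)).2 (by simpa using hc)
  exact Multiset.map_injective hinj h1

variable {F : Type*} [Field F] [Fintype F]

theorem isHomogeneous_aeval_natSum {σ : Type*} (ξ : ℕ → MvPolynomial σ F)
    (hξ : ∀ k, 1 ≤ k → (ξ k).IsHomogeneous (Fintype.card F ^ k + 1)) (i d n : ℕ) :
    (aeval ξ (natSum F i d n)).IsHomogeneous d := by
  simp only [natSum, map_sum, map_prod, map_pow, aeval_X]
  refine IsHomogeneous.sum _ _ _ fun T hT => ?_
  simp only [Finset.mem_filter, Finset.mem_powersetCard] at hT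
  rw [← hT.2]
  refine IsHomogeneous.prod _ _ _ fun p hp => ?_
  exact (hξ _ (Finset.mem_Icc.1 (Finset.mem_product.1 (hT.1.1 hp)).1).1).pow _

variable [CharP F 2]

variable (F)

theorem exists_card_eq_two_pow : ∃ e : ℕ, 0 < e ∧ Fintype.card F = 2 ^ e := by
  obtain ⟨n, -, hn⟩ := FiniteField.card F 2
  exact ⟨n, n.pos, hn⟩

variable {F}

/-- A sum of natural monomials whose degree has base `q` digits `0` and `1` is a Pfaffian. -/
theorem aeval_natSum_eq_pf {A : Type*} [CommRing A] [Algebra F A] (ξ : ℕ → A) (I : Finset ℕ)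
    (i n : ℕ) (hn : I.card = 2 * n) (hI : ∀ k ∈ I, ∀ l ∈ I, l - k ≤ i) :
    aeval ξ (natSum F i (∑ l ∈ I, Fintype.card F ^ l) n) =
      pf (fun k l => ξ (l - k) ^ Fintype.card F ^ k) I := by
  classical
  obtain ⟨e, he, hq⟩ := exists_card_eq_two_pow F
  set q := Fintype.card F with hqdef
  have hq2 : 1 < q := Fintype.one_lt_card
  let φ : Multiset ℕ →+ ℕ := Multiset.sumAddMonoidHom.comp (Multiset.mapAddMonoidHom (q ^ ·))
  have hφ : ∀ s, φ s = (s.map (q ^ ·)).sum := fun s => rfl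
  have hφT : ∀ T : Finset (ℕ × ℕ), φ (∑ p ∈ T, ({p.1, p.2} : Multiset ℕ)) =
      ∑ p ∈ T, (q ^ p.1 + q ^ p.2) := by
    intro T
    rw [map_sum]
    exact Finset.sum_congr rfl fun p _ => by simp [hφ]
  have hcT : ∀ T : Finset (ℕ × ℕ), (∑ p ∈ T, ({p.1, p.2} : Multiset ℕ)).card = 2 * T.card := by
    intro T
    rw [Multiset.card_sum]
    simp [mul_comm]
  -- The natural factor `ξ_a^(q^b)` has degree `q^b + q^(a+b)`, so it becomes the edge from `b` to
  -- `a + b`.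
  let g : ℕ × ℕ ↪ ℕ × ℕ := ⟨fun p => (p.2, p.1 + p.2), fun a b h => by
    simp only [Prod.mk.injEq] at h
    exact Prod.ext (by omega) h.1⟩
  have hg : ∀ p, g p = (p.2, p.1 + p.2) := fun p => rfl
  have hw : ∀ p : ℕ × ℕ, (q ^ p.1 + 1) * q ^ p.2 = q ^ p.2 + q ^ (p.1 + p.2) := fun p => by ring
  simp only [natSum, map_sum, map_prod, map_pow, aeval_X, pf]
  refine Finset.sum_bij (fun T _ => T.map g) ?_ ?_ ?_ ?_
  · intro T hT
    simp only [Finset.mem_filter, Finset.mem_powersetCard] at hT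
    obtain ⟨⟨hsub, hcard⟩, hsum⟩ := hT
    have hM : IsMatching I (T.map g) := by
      refine ⟨?_, ?_⟩
      · intro p' hp'
        obtain ⟨p, hp, rfl⟩ := Finset.mem_map.1 hp'
        have := Finset.mem_Icc.1 (Finset.mem_product.1 (hsub hp)).1
        rw [hg]
        dsimp only
        omega
      -- Here the natural degree matters: the `n` edges have `2n = |I|` ends, so the degree equation
      -- expresses a shortest expansion and the ends exhaust `I` exactly once.
      · refine eq_of_sum_pow_eq he _ _ ?_ (by rw [hcT, Finset.card_map, hcard, hn])
        rw [← hq, ← hφ, hφT, Finset.sum_map, ← hsum]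
        exact Finset.sum_congr rfl fun p _ => (hw p).symm
    exact Finset.mem_filter.2 ⟨hM.mem_powerset, hM⟩
  · exact fun _ _ _ _ h => Finset.map_injective g h
  · intro T hT
    have hM := (Finset.mem_filter.1 hT).2
    have hback : ∀ p ∈ T, g (p.2 - p.1, p.1) = p := by
      intro p hp
      have := hM.1 p hp
      rw [hg]
      exact Prod.ext rfl (by dsimp only; omega)
    have hmap : (T.image fun p => (p.2 - p.1, p.1)).map g = T := by
      rw [Finset.map_eq_image, Finset.image_image]
      conv_rhs => rw [← Finset.image_id (s := T)]
      exact Finset.image_congr fun p hp => hback p hp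
    refine ⟨T.image fun p => (p.2 - p.1, p.1), ?_, hmap⟩
    simp only [Finset.mem_filter, Finset.mem_powersetCard]
    have hcard := hcT T
    rw [hM.2, Finset.card_val, hn] at hcard
    refine ⟨⟨?_, ?_⟩, ?_⟩
    · intro p' hp'
      obtain ⟨p, hp, rfl⟩ := Finset.mem_image.1 hp'
      have h1 := hM.1 p hp
      have h2 := hM.mem hp
      simp only [Finset.mem_product, Finset.mem_Icc, Finset.mem_range]
      refine ⟨⟨by omega, hI _ h2.1 _ h2.2⟩, ?_⟩
      have h3 : q ^ p.1 ≤ ∑ l ∈ I, q ^ l :=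
        Finset.single_le_sum (f := fun l => q ^ l) (fun _ _ => Nat.zero_le _) h2.1
      have h4 : p.1 < q ^ p.1 := Nat.lt_pow_self hq2
      omega
    · rw [← Finset.card_map g, hmap]
      omega
    · have h1 := hφT T
      rw [hM.2, hφ] at h1
      have h2 : ∑ p ∈ (T.image fun p => (p.2 - p.1, p.1)), (q ^ p.1 + 1) * q ^ p.2 =
          ∑ p ∈ (T.image fun p => (p.2 - p.1, p.1)).map g, (q ^ p.1 + q ^ p.2) := by
        rw [Finset.sum_map]
        exact Finset.sum_congr rfl fun p _ => hw p
      rw [h2, hmap, ← h1]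
      rfl
  · intro T _
    rw [Finset.prod_map]
    refine Finset.prod_congr rfl fun p _ => ?_
    rw [hg]
    simp [hqdef]

end NaturalMonomials

/-! ### Moore determinants and the polynomial with prescribed roots. -/

section Moore

set_option linter.unusedSectionVars false

variable (F : Type*) [Field F] [Fintype F]

/-- The `i`-th iterate of the `q`-power Frobenius. -/
def frobPow (R : Type*) [CommRing R] [Algebra F R] (i : ℕ) : R →ₐ[F] R :=
  FiniteField.frobeniusAlgHom F R ^ i

theorem frobPow_apply {R : Type*} [CommRing R] [Algebra F R] (i : ℕ) (r : R) :
    frobPow F R i r = r ^ Fintype.card F ^ i := by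
  induction i with
  | zero => simp [frobPow]
  | succ i ih =>
    rw [frobPow, pow_succ', AlgHom.mul_apply, ← frobPow, ih, FiniteField.coe_frobeniusAlgHom]
    dsimp only
    rw [← pow_mul, ← pow_succ]

theorem sum_smul_pow_card {R ι : Type*} [CommRing R] [Algebra F R] [Fintype ι] (a : ι → F)
    (w : ι → R) (i : ℕ) :
    (∑ j, a j • w j) ^ Fintype.card F ^ i = ∑ j, a j • w j ^ Fintype.card F ^ i := by
  simp only [← frobPow_apply, map_sum, map_smul]

variable {R : Type*} [CommRing R] [Algebra F R] {n : ℕ}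

/-- The Moore determinant. -/
def moore (w : Fin n → R) : R := Matrix.det (Matrix.of fun i j => w j ^ Fintype.card F ^ (i : ℕ))

/-- The determinant of the Moore matrix with an additional row, the row `i` being omitted. -/
def mooreMinor (w : Fin n → R) (i : Fin (n + 1)) : R :=
  Matrix.det (Matrix.of fun k j => w j ^ Fintype.card F ^ (i.succAbove k : ℕ))

/-- The product of all `X + v`, where `v` runs over the linear combinations of `w`. -/
def dicksonPoly (w : Fin n → R) : Polynomial R :=
  ∏ a : Fin n → F, (Polynomial.X + Polynomial.C (∑ j, a j • w j))

theorem map_moore {S : Type*} [CommRing S] [Algebra F S] (f : R →+* S) (w : Fin n → R) :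
    f (moore F w) = moore F fun j => f (w j) := by
  rw [moore, RingHom.map_det, moore]
  congr 1
  ext i j
  simp

theorem monic_dicksonPoly (w : Fin n → R) : (dicksonPoly F w).Monic :=
  Polynomial.monic_prod_of_monic _ _ fun _ _ => Polynomial.monic_X_add_C _

theorem natDegree_dicksonPoly [Nontrivial R] (w : Fin n → R) :
    (dicksonPoly F w).natDegree = Fintype.card F ^ n := by
  rw [dicksonPoly, Polynomial.natDegree_prod_of_monic _ _ fun _ _ => Polynomial.monic_X_add_C _]
  simp only [Polynomial.natDegree_X_add_C]
  simp

theorem moore_snoc_X [CharP R 2] (w : Fin n → R) :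
    moore F (Fin.snoc (fun j => Polynomial.C (w j)) Polynomial.X : Fin (n + 1) → Polynomial R) =
      ∑ i : Fin (n + 1), Polynomial.C (mooreMinor F w i) *
        Polynomial.X ^ Fintype.card F ^ (i : ℕ) := by
  rw [moore, Matrix.det_succ_column _ (Fin.last n)]
  refine Finset.sum_congr rfl fun i _ => ?_
  have hs : ((-1 : Polynomial R) ^ ((i : ℕ) + (Fin.last n : Fin (n + 1)))) = 1 := by
    rw [CharTwo.neg_eq, one_pow]
  rw [hs, one_mul, mul_comm, mooreMinor, RingHom.map_det]
  congr 2
  · ext1 k j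
    simp
  · simp

theorem eval_dicksonPoly [CharP R 2] (w : Fin n → R) (a : Fin n → F) :
    (dicksonPoly F w).eval (∑ j, a j • w j) = 0 := by
  rw [dicksonPoly, Polynomial.eval_prod]
  refine Finset.prod_eq_zero (Finset.mem_univ a) ?_
  rw [Polynomial.eval_add, Polynomial.eval_X, Polynomial.eval_C, CharTwo.add_self_eq_zero]

variable [IsDomain R]

theorem moore_snoc_eq_zero (w : Fin n → R) (a : Fin n → F) :
    moore F (Fin.snoc w (∑ j, a j • w j) : Fin (n + 1) → R) = 0 := by
  rw [moore, ← Matrix.exists_mulVec_eq_zero_iff]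
  refine ⟨Fin.snoc (fun j => algebraMap F R (a j)) (-1), ?_, ?_⟩
  · intro h
    have := congrFun h (Fin.last n)
    simp at this
  · ext i
    simp only [Matrix.mulVec, dotProduct, Matrix.of_apply, Fin.sum_univ_castSucc, Fin.snoc_castSucc,
      Fin.snoc_last, sum_smul_pow_card, Pi.zero_apply]
    simp [Algebra.smul_def, mul_comm]

variable [CharP R 2]

theorem injective_sum_smul {w : Fin n → R} (hw : LinearIndependent F w) :
    Function.Injective fun a : Fin n → F => ∑ j, a j • w j := by
  intro a b hab
  rw [Fintype.linearIndependent_iff] at hw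
  have := hw (a - b) (by simpa [sub_smul, sub_eq_zero] using hab)
  ext i
  exact sub_eq_zero.1 (this i)

/-- Both sides have degree at most `q^n` with the same coefficient there, and both vanish at the
`q^n` distinct linear combinations of `w`. -/
theorem moore_snoc_X_eq {w : Fin n → R} (hw : LinearIndependent F w) :
    moore F (Fin.snoc (fun j => Polynomial.C (w j)) Polynomial.X : Fin (n + 1) → Polynomial R) =
      Polynomial.C (moore F w) * dicksonPoly F w := by
  classical
  have hlast : mooreMinor F w (Fin.last n) = moore F w := by
    simp [mooreMinor, moore]
  have hinj : Function.Injective fun a : Fin n → F => ∑ j, a j • w j :=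
    injective_sum_smul F hw
  have hq : 1 < Fintype.card F := Fintype.one_lt_card
  rw [← sub_eq_zero]
  refine Polynomial.eq_zero_of_degree_lt_of_eval_index_eq_zero
    (s := (Finset.univ : Finset (Fin n → F))) (v := fun a : Fin n → F => ∑ j, a j • w j)
    hinj.injOn ?_ ?_
  · rw [Polynomial.degree_lt_iff_coeff_zero]
    intro k hk
    simp only [Finset.card_univ, Fintype.card_fun, Fintype.card_fin] at hk
    rw [Polynomial.coeff_sub, Polynomial.coeff_C_mul, moore_snoc_X, Polynomial.finsetSum_coeff]
    simp only [Polynomial.coeff_C_mul, Polynomial.coeff_X_pow]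
    rw [Finset.sum_eq_single (Fin.last n)]
    · rw [hlast, ← mul_sub]
      convert mul_zero _
      split_ifs with h
      · rw [h, Fin.val_last, ← natDegree_dicksonPoly F w, (monic_dicksonPoly F w).coeff_natDegree,
          sub_self]
      · rw [Polynomial.coeff_eq_zero_of_natDegree_lt, sub_self]
        rw [natDegree_dicksonPoly]
        exact lt_of_le_of_ne hk (Ne.symm h)
    · intro i _ hi
      have h1 : (i : ℕ) < n := Fin.val_lt_last hi
      have h2 := Nat.pow_lt_pow_right hq h1
      rw [if_neg (by omega), mul_zero]
    · simp
  · intro a _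
    rw [Polynomial.eval_sub, Polynomial.eval_mul, eval_dicksonPoly, mul_zero, sub_zero]
    have h1 := map_moore F (Polynomial.evalRingHom (∑ j, a j • w j))
      (Fin.snoc (fun j => Polynomial.C (w j)) Polynomial.X : Fin (n + 1) → Polynomial R)
    rw [Polynomial.coe_evalRingHom] at h1
    rw [h1, ← moore_snoc_eq_zero F w a]
    congr 1
    ext j
    refine Fin.lastCases ?_ (fun j => ?_) j <;> simp

theorem moore_snoc {w : Fin n → R} (hw : LinearIndependent F w) (r : R) :
    moore F (Fin.snoc w r : Fin (n + 1) → R) = moore F w * ∏ a : Fin n → F, (r + ∑ j, a j • w j) := by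
  have h1 := map_moore F (Polynomial.evalRingHom r)
    (Fin.snoc (fun j => Polynomial.C (w j)) Polynomial.X : Fin (n + 1) → Polynomial R)
  rw [moore_snoc_X_eq F hw] at h1
  simp only [Polynomial.coe_evalRingHom, Polynomial.eval_mul, Polynomial.eval_C, dicksonPoly,
    Polynomial.eval_prod, Polynomial.eval_add, Polynomial.eval_X] at h1
  rw [h1]
  congr 1
  ext j
  refine Fin.lastCases ?_ (fun j => ?_) j <;> simp

/-- The Moore determinant is the product of its orbit products. -/
theorem moore_eq_prod {w : Fin n → R} (hw : LinearIndependent F w) :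
    moore F w = ∏ k : Fin n, ∏ a : Fin k → F, (w k + ∑ j : Fin k, a j • w (Fin.castLE k.isLt.le j)) := by
  induction n with
  | zero => simp [moore]
  | succ n ih =>
    have hw' : LinearIndependent F (Fin.init w) := hw.comp _ (Fin.castSucc_injective n)
    rw [Fin.prod_univ_castSucc]
    conv_lhs => rw [← Fin.snoc_init_self w]
    rw [moore_snoc F hw', ih hw']
    rfl

theorem moore_ne_zero {w : Fin n → R} (hw : LinearIndependent F w) : moore F w ≠ 0 := by
  rw [moore_eq_prod F hw, Finset.prod_ne_zero_iff]
  intro k _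
  rw [Finset.prod_ne_zero_iff]
  intro a _ h
  classical
  rw [Fintype.linearIndependent_iff] at hw
  -- A vanishing orbit factor is a linear relation with coefficient 1 at `w k`.
  let c : Fin n → F := fun i => if h : i < k then a ⟨i, h⟩ else if i = k then 1 else 0
  have hc : ∑ i, c i • w i = 0 := by
    rw [← h, add_comm, ← Finset.sum_filter_add_sum_filter_not Finset.univ (fun i => i < k)]
    congr 1
    · symm
      refine Finset.sum_bij (fun j _ => Fin.castLE k.isLt.le j) ?_ ?_ ?_ ?_
      · intro j _
        exact Finset.mem_filter.2 ⟨Finset.mem_univ _, j.isLt⟩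
      · intro j _ j' _ hj
        simpa using hj
      · intro i hi
        have hi : i < k := (Finset.mem_filter.1 hi).2
        exact ⟨⟨i, hi⟩, Finset.mem_univ _, rfl⟩
      · intro j _
        have : Fin.castLE k.isLt.le j < k := j.isLt
        simp only [c, dif_pos this]
        rfl
    · rw [Finset.sum_eq_single k]
      · simp [c]
      · intro i hi hik
        have hi : ¬ i < k := (Finset.mem_filter.1 hi).2
        simp [c, hi, hik]
      · simp
  have := hw c hc k
  simp [c] at this

theorem moore_mul_coeff {w : Fin n → R} (hw : LinearIndependent F w) (k : ℕ) :
    moore F w * (dicksonPoly F w).coeff k =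
      ∑ i : Fin (n + 1), if k = Fintype.card F ^ (i : ℕ) then mooreMinor F w i else 0 := by
  rw [← Polynomial.coeff_C_mul, ← moore_snoc_X_eq F hw, moore_snoc_X, Polynomial.finsetSum_coeff]
  simp only [Polynomial.coeff_C_mul, Polynomial.coeff_X_pow, mul_ite, mul_one, mul_zero]

theorem moore_mul_coeff_pow {w : Fin n → R} (hw : LinearIndependent F w) (i : Fin (n + 1)) :
    moore F w * (dicksonPoly F w).coeff (Fintype.card F ^ (i : ℕ)) = mooreMinor F w i := by
  rw [moore_mul_coeff F hw, Finset.sum_eq_single i]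
  · simp
  · intro j _ hj
    rw [if_neg]
    intro h
    exact hj (Fin.ext (Nat.pow_right_injective Fintype.one_lt_card h).symm)
  · simp

/-- Column expansion of the Moore determinant produces only `q`-power exponents, and the Moore
factor can be cancelled. -/
theorem dicksonPoly_eq_sum {w : Fin n → R} (hw : LinearIndependent F w) :
    dicksonPoly F w = ∑ i ∈ Finset.range (n + 1),
      Polynomial.C ((dicksonPoly F w).coeff (Fintype.card F ^ i)) *
        Polynomial.X ^ Fintype.card F ^ i := by
  have h := moore_snoc_X_eq F hw
  have h0 : Polynomial.C (moore F w) ≠ 0 := Polynomial.C_ne_zero.2 (moore_ne_zero F hw)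
  apply mul_left_cancel₀ h0
  rw [← h, moore_snoc_X, Finset.mul_sum, Finset.sum_range]
  refine Finset.sum_congr rfl fun i _ => ?_
  rw [← mul_assoc, ← Polynomial.C_mul, moore_mul_coeff_pow F hw]

/-- Omitting row zero leaves the Frobenius twist of the Moore matrix. -/
theorem mooreMinor_zero (w : Fin n → R) : mooreMinor F w 0 = moore F w ^ Fintype.card F := by
  have h := map_moore F (FiniteField.frobeniusAlgHom F R).toRingHom w
  simp only [AlgHom.toRingHom_eq_coe, RingHom.coe_coe, FiniteField.coe_frobeniusAlgHom] at h
  rw [h, mooreMinor, moore]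
  congr 1
  ext i j
  simp [← pow_mul, pow_succ']

theorem coeff_one_dicksonPoly {w : Fin n → R} (hw : LinearIndependent F w) :
    (dicksonPoly F w).coeff 1 = moore F w ^ (Fintype.card F - 1) := by
  have h := moore_mul_coeff_pow F hw 0
  rw [mooreMinor_zero] at h
  apply mul_left_cancel₀ (moore_ne_zero F hw)
  rw [← pow_succ', Nat.sub_add_cancel Fintype.card_pos, ← h]
  simp

end Moore

/-! ### The `ξ`'s as Gram entries; `u`, `u_{m-1}` and `δ_{jk}` as Pfaffians. -/

section Coordinates

variable {F : Type*} [Field F]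

/-- The index of the variable `w j`. -/
def wVar (m : ℕ) : Fin (m + m) → Var m :=
  Fin.append (fun i => Sum.inr (Sum.inr i)) fun i => Sum.inl i.rev

theorem wVar_castAdd (m : ℕ) (i : Fin m) : wVar m (Fin.castAdd m i) = Sum.inr (Sum.inr i) :=
  Fin.append_left _ _ i

theorem wVar_natAdd (m : ℕ) (i : Fin m) : wVar m (Fin.natAdd m i) = Sum.inl i.rev :=
  Fin.append_right _ _ i

theorem w_castAdd [Fintype F] (m : ℕ) (i : Fin m) : w F m (Fin.castAdd m i) = x F m i :=
  Fin.append_left _ _ i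

theorem w_natAdd [Fintype F] (m : ℕ) (i : Fin m) : w F m (Fin.natAdd m i) = y F m i.rev :=
  Fin.append_right _ _ i

theorem w_eq_X [Fintype F] (m : ℕ) (j : Fin (m + m)) : w F m j = X (wVar m j) := by
  refine Fin.addCases (fun i => ?_) (fun i => ?_) j
  · rw [w_castAdd, wVar_castAdd, x]
  · rw [w_natAdd, wVar_natAdd, y]

theorem wVar_injective (m : ℕ) : Function.Injective (wVar m) := by
  intro j k
  refine Fin.addCases (fun i => ?_) (fun i => ?_) j <;>
    refine Fin.addCases (fun i' => ?_) (fun i' => ?_) k <;>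
    simp only [wVar_castAdd, wVar_natAdd] <;> intro h
  · rw [Sum.inr_injective (Sum.inr_injective h)]
  · cases h
  · cases h
  · rw [Fin.rev_injective (Sum.inl_injective h)]

theorem wVar_ne_z (m : ℕ) (j : Fin (m + m)) : wVar m j ≠ Sum.inr (Sum.inl ()) := by
  refine Fin.addCases (fun i => ?_) (fun i => ?_) j <;>
    simp only [wVar_castAdd, wVar_natAdd] <;> intro h
  · cases Sum.inr_injective h
  · cases h

theorem eq_z_or_exists_wVar (m : ℕ) (i : Var m) :
    i = Sum.inr (Sum.inl ()) ∨ ∃ j, i = wVar m j := by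
  rcases i with i | ⟨⟨⟩⟩ | i
  · exact Or.inr ⟨Fin.natAdd m i.rev, by rw [wVar_natAdd, Fin.rev_rev]⟩
  · exact Or.inl rfl
  · exact Or.inr ⟨Fin.castAdd m i, by rw [wVar_castAdd]⟩

theorem sum_wVar_add {A : Type*} [AddCommMonoid A] (m : ℕ) (f : Var m → A) :
    ∑ i, f i = ∑ j, f (wVar m j) + f (Sum.inr (Sum.inl ())) := by
  rw [Fintype.sum_sum_type, Fintype.sum_sum_type, Fin.sum_univ_add]
  simp only [wVar_castAdd, wVar_natAdd, Finset.univ_unique, Finset.sum_singleton]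
  rw [show ∑ i : Fin m, f (Sum.inl i.rev) = ∑ i : Fin m, f (Sum.inl i) from
    Equiv.sum_comp Fin.revPerm fun i => f (Sum.inl i)]
  change _ + (f (Sum.inr (Sum.inl ())) + _) = _
  abel

theorem rev_castAdd (m : ℕ) (i : Fin m) : (Fin.castAdd m i).rev = Fin.natAdd m i.rev := by
  ext
  simp only [Fin.val_rev, Fin.val_castAdd, Fin.val_natAdd]
  omega

theorem rev_natAdd (m : ℕ) (i : Fin m) : (Fin.natAdd m i).rev = Fin.castAdd m i.rev := by
  ext
  simp only [Fin.val_rev, Fin.val_castAdd, Fin.val_natAdd]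
  omega

variable (F) [Fintype F]

theorem linearIndependent_w (m : ℕ) : LinearIndependent F (w F m) := by
  have h : w F m = fun j => X (wVar m j) := funext fun j => w_eq_X m j
  rw [h]
  exact (linearIndependent_X _ F).comp _ (wVar_injective m)

/-- The vector of the `q ^ k`-th powers of the variables `w`. -/
def row (m k : ℕ) : Fin (m + m) → Sz F m := fun j => w F m j ^ Fintype.card F ^ k

theorem xi_succ (m k : ℕ) : xi F m (k + 1) =
    ∑ j, (x F m j * y F m j ^ Fintype.card F ^ (k + 1)
      + y F m j * x F m j ^ Fintype.card F ^ (k + 1)) := rfl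

theorem form_eq_sum {R : Type*} [CommRing R] {m : ℕ} (v v' : Fin (m + m) → R) :
    form v v' = ∑ i : Fin m, (v (Fin.castAdd m i) * v' (Fin.natAdd m i.rev) +
      v (Fin.natAdd m i.rev) * v' (Fin.castAdd m i)) := by
  rw [form, Fin.sum_univ_add, Finset.sum_add_distrib]
  have h1 : ∀ i : Fin m, v (Fin.castAdd m i) * v' (Fin.castAdd m i).rev =
      v (Fin.castAdd m i) * v' (Fin.natAdd m i.rev) := fun i => by rw [rev_castAdd]
  have h2 : ∑ i : Fin m, v (Fin.natAdd m i) * v' (Fin.natAdd m i).rev =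
      ∑ i : Fin m, v (Fin.natAdd m i.rev) * v' (Fin.castAdd m i) := by
    rw [← Equiv.sum_comp Fin.revPerm]
    refine Finset.sum_congr rfl fun i _ => ?_
    rw [Fin.revPerm_apply, rev_natAdd, Fin.rev_rev]
  rw [Finset.sum_congr rfl fun i _ => h1 i, h2]

theorem row_castAdd (m k : ℕ) (i : Fin m) :
    row F m k (Fin.castAdd m i) = x F m i ^ Fintype.card F ^ k := by
  rw [row, w_castAdd]

theorem row_natAdd (m k : ℕ) (i : Fin m) :
    row F m k (Fin.natAdd m i) = y F m i.rev ^ Fintype.card F ^ k := by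
  rw [row, w_natAdd]

/-- The case `k = 0` must be excluded: the form is alternating, whereas `ξ₀` is the quadratic form.
-/
theorem xi_eq_form (m : ℕ) {k : ℕ} (hk : 1 ≤ k) : xi F m k = form (row F m 0) (row F m k) := by
  obtain ⟨k, rfl⟩ := Nat.exists_eq_add_of_le' hk
  rw [xi_succ, form_eq_sum]
  simp only [row_castAdd, row_natAdd, Fin.rev_rev, pow_zero, pow_one]

theorem form_row (m : ℕ) {k l : ℕ} (h : k < l) :
    form (row F m k) (row F m l) = xi F m (l - k) ^ Fintype.card F ^ k := by
  rw [xi_eq_form F m (by omega), ← frobPow_apply, form, form, map_sum]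
  refine Finset.sum_congr rfl fun j _ => ?_
  rw [map_mul, frobPow_apply, frobPow_apply]
  simp only [row, ← pow_mul, ← pow_add]
  rw [show 0 + k = k by omega, show l - k + k = l by omega]

theorem isHomogeneous_w (m : ℕ) (j : Fin (m + m)) : (w F m j).IsHomogeneous 1 := by
  rw [w_eq_X]
  exact isHomogeneous_X _ _

theorem isHomogeneous_xi (m : ℕ) (k : ℕ) (hk : 1 ≤ k) :
    (xi F m k).IsHomogeneous (Fintype.card F ^ k + 1) := by
  rw [xi_eq_form F m hk]
  refine IsHomogeneous.sum _ _ _ fun j _ => ?_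
  have h := ((isHomogeneous_w F m j).pow (Fintype.card F ^ 0)).mul
    ((isHomogeneous_w F m j.rev).pow (Fintype.card F ^ k))
  rw [one_mul, one_mul] at h
  rwa [pow_zero, Nat.add_comm 1 (Fintype.card F ^ k), ← pow_zero (Fintype.card F)] at h

open Classical in
theorem dicksonPoly_eq_X_mul {R : Type*} [CommRing R] [Algebra F R] {n : ℕ} (v : Fin n → R) :
    dicksonPoly F v = Polynomial.X * ∏ a ∈ Finset.univ.filter (fun a : Fin n → F => a ≠ 0),
        (Polynomial.X + Polynomial.C (∑ j, a j • v j)) := by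
  have h0 : Polynomial.X + Polynomial.C (∑ j, (0 : Fin n → F) j • v j) = Polynomial.X := by
    simp
  rw [dicksonPoly, ← Finset.mul_prod_erase _ _ (Finset.mem_univ 0), h0, Finset.filter_ne']

/-- Including the zero form adds the factor `X`, which shifts the exponent by one. -/
theorem dickson_eq_coeff (m i : ℕ) :
    dickson F m i = (dicksonPoly F (w F m)).coeff (Fintype.card F ^ (2 * m - i)) := by
  have hq : 0 < Fintype.card F ^ (2 * m - i) := pow_pos Fintype.card_pos _
  have hk : Fintype.card F ^ (2 * m - i) = Fintype.card F ^ (2 * m - i) - 1 + 1 := by omega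
  rw [dicksonPoly_eq_X_mul, hk, Polynomial.coeff_X_mul, dickson]
  simp only [smul_eq_C_mul]

variable [CharP F 2]

theorem u_eq_moore (m : ℕ) : u F m = moore F (w F m) := by
  rw [moore_eq_prod F (linearIndependent_w F m)]
  simp only [u, orbitProd, smul_eq_C_mul]

/-- The Pfaffian in the `ξ`'s. -/
def xiPf (m : ℕ) (I : Finset ℕ) : Sz F m :=
  pf (fun k l => xi F m (l - k) ^ Fintype.card F ^ k) I

theorem u_eq_xiPf (m : ℕ) : u F m = xiPf F m (Finset.range (m + m)) := by
  rw [u_eq_moore, moore]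
  have h := pf_form_eq_det (row F m)
  rw [xiPf, ← pf_congr (a := fun i j => form (row F m i) (row F m j)), h]
  · rfl
  · exact fun i _ j _ hij => form_row F m hij

theorem uPrev_eq_xiPf (m : ℕ) : uPrev F m = xiPf F m (Finset.range (2 * m - 2)) := by
  rw [uPrev, uPrevPoly, aeval_natSum_eq_pf, xiPf]
  · rw [Finset.card_range]
    omega
  · intro k hk l hl
    simp only [Finset.mem_range] at hk hl
    omega

/-- The Pfaffian has `2m - 2` indices, which in `S_{m-1}` is the number of variables, so there it is
the full Moore determinant. -/
theorem aeval_uPrevPoly (m : ℕ) (hm : 1 ≤ m) :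
    aeval (xi F (m - 1)) (uPrevPoly F m) = u F (m - 1) := by
  rw [uPrevPoly, aeval_natSum_eq_pf, u_eq_xiPf, xiPf]
  · congr 2
    omega
  · rw [Finset.card_range]
    omega
  · intro k hk l hl
    simp only [Finset.mem_range] at hk hl
    omega

theorem u_eq_aeval (m : ℕ) : u F m = aeval (xi F m) (uPrevPoly F (m + 1)) :=
  (aeval_uPrevPoly F (m + 1) (by omega)).symm

theorem deltaPair_eq_xiPf (m : ℕ) {j k : ℕ} (hj : 1 ≤ j) (hjk : j < k) (hk : k < 2 * m - 1) :
    deltaPair F m j k = xiPf F m (((Finset.Icc 1 (2 * m - 2)).erase j).erase k) := by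
  rw [deltaPair, aeval_natSum_eq_pf, xiPf]
  · rw [Finset.card_erase_of_mem, Finset.card_erase_of_mem, Nat.card_Icc]
    · omega
    · simp; omega
    · simp; omega
  · intro a ha b hb
    simp only [Finset.mem_erase, Finset.mem_Icc] at ha hb
    omega

/-- Frobenius raises the twist of every Gram entry by one, which translates the index set. -/
theorem uPrev_pow_eq_xiPf (m : ℕ) :
    uPrev F m ^ Fintype.card F = xiPf F m (Finset.Icc 1 (2 * m - 2)) := by
  have h1 : Finset.Icc 1 (2 * m - 2) =
      (Finset.range (2 * m - 2)).map (OrderEmbedding.addRight 1).toEmbedding := by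
    ext k
    simp only [Finset.mem_Icc, Finset.mem_map, Finset.mem_range, RelEmbedding.coe_toEmbedding]
    constructor
    · intro h
      exact ⟨k - 1, by omega, by change k - 1 + 1 = k; omega⟩
    · rintro ⟨a, ha, rfl⟩
      change 1 ≤ a + 1 ∧ a + 1 ≤ _
      omega
  rw [uPrev_eq_xiPf, xiPf, xiPf, h1, pf_map]
  have h2 := map_pf (FiniteField.frobeniusAlgHom F (Sz F m)).toRingHom
    (fun k l => xi F m (l - k) ^ Fintype.card F ^ k) (Finset.range (2 * m - 2))
  simp only [AlgHom.toRingHom_eq_coe, RingHom.coe_coe, FiniteField.coe_frobeniusAlgHom] at h2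
  rw [h2]
  congr 1
  funext k l
  change _ = xi F m (l + 1 - (k + 1)) ^ Fintype.card F ^ (k + 1)
  rw [← pow_mul, ← pow_succ, Nat.add_sub_add_right]

end Coordinates

/-! ### Derivatives of determinants and of the first Dickson invariant. -/

section Derivation

set_option linter.unusedSectionVars false

variable {F : Type*} [Field F] {R : Type*} [CommRing R] [Algebra F R]

theorem derivation_prod_eq_zero {ι : Type*} (D : Derivation F R R) (s : Finset ι) (f : ι → R)
    (h : ∀ i ∈ s, D (f i) = 0) : D (∏ i ∈ s, f i) = 0 := by
  classical
  induction s using Finset.induction_on with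
  | empty => simp
  | insert i s hi ih =>
    rw [Finset.prod_insert hi, Derivation.leibniz, h i (Finset.mem_insert_self i s),
      ih fun j hj => h j (Finset.mem_insert_of_mem hj)]
    simp

theorem derivation_det_eq_zero {n : ℕ} (D : Derivation F R R) (M : Matrix (Fin n) (Fin n) R)
    (h : ∀ i j, D (M i j) = 0) : D M.det = 0 := by
  rw [Matrix.det_apply, map_sum]
  refine Finset.sum_eq_zero fun σ _ => ?_
  rw [Units.smul_def, map_zsmul, derivation_prod_eq_zero _ _ _ fun i _ => h _ _, smul_zero]

/-- A derivation that kills all rows but the first acts on the determinant through the first. -/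
theorem derivation_det {n : ℕ} (D : Derivation F R R) (M : Matrix (Fin (n + 1)) (Fin (n + 1)) R)
    (h : ∀ i : Fin n, ∀ j, D (M i.succ j) = 0) :
    D M.det = (M.updateRow 0 fun j => D (M 0 j)).det := by
  rw [Matrix.det_succ_row_zero, Matrix.det_succ_row_zero, map_sum]
  refine Finset.sum_congr rfl fun j _ => ?_
  have h1 : D ((M.submatrix Fin.succ j.succAbove).det) = 0 :=
    derivation_det_eq_zero D _ fun i k => h i _
  have h2 : (M.updateRow 0 fun j => D (M 0 j)).submatrix Fin.succ j.succAbove =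
      M.submatrix Fin.succ j.succAbove := by
    ext i k
    simp [Matrix.updateRow_ne]
  have h3 : D ((-1 : R) ^ (j : ℕ)) = 0 := by
    have h4 : D (-1 : R) = 0 := by rw [map_neg, Derivation.map_one_eq_zero, neg_zero]
    rw [Derivation.leibniz_pow, h4, smul_zero, smul_zero]
  rw [h2, Matrix.updateRow_self, Derivation.leibniz, Derivation.leibniz, h1, h3]
  simp only [smul_eq_mul]
  ring

variable [Fintype F] [CharP R 2] [IsDomain R]

theorem two_dvd_card [CharP F 2] : 2 ∣ Fintype.card F := by
  obtain ⟨e, he, h⟩ := exists_card_eq_two_pow F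
  rw [h]
  exact dvd_pow_self 2 he.ne'

theorem derivation_pow_even (D : Derivation F R R) (r : R) {k : ℕ} (hk : 2 ∣ k) :
    D (r ^ k) = 0 := by
  rw [Derivation.leibniz_pow, ← Nat.cast_smul_eq_nsmul R, (CharP.cast_eq_zero_iff R 2 k).2 hk,
    zero_smul]

variable [CharP F 2]

theorem derivation_pow_card (D : Derivation F R R) (r : R) {k : ℕ} (hk : 1 ≤ k) :
    D (r ^ Fintype.card F ^ k) = 0 :=
  derivation_pow_even D r (dvd_pow two_dvd_card (by omega))

/-- Each `v j` is a root of the monic polynomial `dicksonPoly F v`, whose exponents are powers of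
`q`. -/
theorem pow_card_eq_sum {n : ℕ} {v : Fin n → R} (hv : LinearIndependent F v) (j : Fin n) :
    v j ^ Fintype.card F ^ n = ∑ k : Fin n,
      (dicksonPoly F v).coeff (Fintype.card F ^ (k : ℕ)) * v j ^ Fintype.card F ^ (k : ℕ) := by
  classical
  have h1 : (dicksonPoly F v).eval (v j) = 0 := by
    have := eval_dicksonPoly F v (Pi.single j 1)
    simpa [Pi.single_apply, ite_smul] using this
  have h2 : (dicksonPoly F v).coeff (Fintype.card F ^ n) = 1 := by
    rw [← natDegree_dicksonPoly F v]
    exact monic_dicksonPoly F v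
  rw [dicksonPoly_eq_sum F hv, Polynomial.eval_finsetSum, Finset.sum_range_succ, h2] at h1
  simp only [Polynomial.eval_mul, Polynomial.eval_C, Polynomial.eval_pow, Polynomial.eval_X,
    one_mul] at h1
  rw [Finset.sum_range] at h1
  exact (CharTwo.add_eq_zero.1 h1).symm

/-- The derivative of the top Dickson invariant. -/
theorem derivation_dicksonPoly_coeff (D : Derivation F R R) {n : ℕ} (hn : 1 ≤ n)
    {v : Fin (n + 1) → R} (hv : LinearIndependent F v) :
    D ((dicksonPoly F v).coeff (Fintype.card F ^ n)) = moore F v ^ (Fintype.card F - 2) *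
      Matrix.det (Matrix.of fun (i : Fin (n + 1)) j =>
        if i = 0 then D (v j) else if i = Fin.last n then v j
          else v j ^ Fintype.card F ^ (i : ℕ)) := by
  have h0l : (0 : Fin (n + 1)) ≠ Fin.last n := by
    intro h
    have := congrArg Fin.val h
    simp at this
    omega
  set c := fun k : ℕ => (dicksonPoly F v).coeff (Fintype.card F ^ k) with hc
  let M : Matrix (Fin (n + 1)) (Fin (n + 1)) R :=
    Matrix.of fun i j => v j ^ Fintype.card F ^ (i : ℕ)
  let A := M.updateRow 0 fun j => D (v j)
  have hA0 : ∀ k, k ≠ 0 → A k = M k := fun k hk => Matrix.updateRow_ne hk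
  have hAz : A 0 = fun j => D (v j) := Matrix.updateRow_self
  -- All rows but the first consist of `q`-th powers, which `D` kills.
  have hDu : D (moore F v) = A.det := by
    rw [moore, derivation_det D]
    · simp [A, M]
    · intro i j
      exact derivation_pow_card D _ (by simp)
  let k₀ : Fin (n + 2) := (Fin.last n).castSucc
  have hminor : moore F v * c n = mooreMinor F v k₀ := moore_mul_coeff_pow F hv k₀
  have hsA : ∀ i : Fin (n + 1), (k₀.succAbove i : ℕ) = if i = Fin.last n then n + 1 else i := by
    intro i
    split_ifs with h
    · rw [h, Fin.succAbove_of_le_castSucc _ _ le_rfl]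
      simp
    · have h2 : (i : ℕ) < n := Fin.val_lt_last h
      rw [Fin.succAbove_of_castSucc_lt _ _ (by simpa [k₀, Fin.lt_def] using h2)]
      simp
  have hDm : D (mooreMinor F v k₀) =
      (A.updateRow (Fin.last n) fun j => v j ^ Fintype.card F ^ (n + 1)).det := by
    rw [mooreMinor, derivation_det D]
    · congr 1
      ext i j
      by_cases hi : i = 0
      · subst hi
        rw [Matrix.updateRow_self, Matrix.updateRow_ne h0l, hAz]
        simp only [Matrix.of_apply, hsA, if_neg h0l]
        simp
      · rw [Matrix.updateRow_ne hi]
        by_cases hl : i = Fin.last n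
        · rw [hl, Matrix.updateRow_self, Matrix.of_apply, hsA, if_pos rfl]
        · rw [Matrix.updateRow_ne hl, hA0 i hi, Matrix.of_apply, hsA, if_neg hl]
          rfl
    · intro i j
      rw [Matrix.of_apply, hsA]
      split_ifs
      · exact derivation_pow_card D _ (by omega)
      · exact derivation_pow_card D _ (by simp)
  let L : (Fin (n + 1) → R) →ₗ[R] R :=
    (Matrix.detRowAlternating (R := R) (n := Fin (n + 1))).toMultilinearMap.toLinearMap A
      (Fin.last n)
  have hL : ∀ r, L r = (A.updateRow (Fin.last n) r).det := fun r => rfl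
  have hrel : (fun j => v j ^ Fintype.card F ^ (n + 1)) = ∑ k : Fin (n + 1), c k • M k := by
    ext j
    rw [pow_card_eq_sum hv j, Finset.sum_apply]
    rfl
  -- Rewriting the last row by lower twists, only the terms `0` and `n` survive: the others repeat a
  -- row, but `v` itself was replaced by `D v`.
  have hDm2 : D (mooreMinor F v k₀) = c 0 * L (M 0) + c n * A.det := by
    rw [hDm, ← hL, hrel, map_sum, Finset.sum_eq_add (0 : Fin (n + 1)) (Fin.last n) h0l]
    · have h1 : L (M (Fin.last n)) = A.det := by
        rw [hL, ← hA0 _ h0l.symm, Matrix.updateRow_eq_self]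
      rw [map_smul, map_smul, h1]
      simp
    · rintro k - ⟨hk0, hkl⟩
      rw [map_smul, hL, Matrix.det_zero_of_row_eq hkl, smul_zero]
      rw [Matrix.updateRow_self, Matrix.updateRow_ne hkl, hA0 k hk0]
    · simp
    · simp
  have hc0 : c 0 = moore F v ^ (Fintype.card F - 1) := by
    rw [← coeff_one_dicksonPoly F hv, hc]
    simp
  have hdet : Matrix.det (Matrix.of fun (i : Fin (n + 1)) j =>
        if i = 0 then D (v j) else if i = Fin.last n then v j
          else v j ^ Fintype.card F ^ (i : ℕ)) = L (M 0) := by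
    rw [hL]
    congr 1
    ext i j
    rw [Matrix.of_apply]
    by_cases hl : i = Fin.last n
    · rw [hl, Matrix.updateRow_self, if_neg h0l.symm, if_pos rfl]
      simp [M]
    · rw [Matrix.updateRow_ne hl]
      by_cases hi : i = 0
      · rw [if_pos hi, hi]
        simp [A]
      · rw [if_neg hi, if_neg hl, hA0 i hi]
        rfl
  -- In the Leibniz rule for `moore F v * c n`, the term `c n * A.det` occurs on both sides. What
  -- remains is `moore F v * D (c n) = moore F v ^ (q - 1) * L (M 0)`.
  have hfin := congrArg D hminor
  rw [hDm2, Derivation.leibniz, hDu, smul_eq_mul, smul_eq_mul, hc0] at hfin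
  have hq : Fintype.card F - 1 = Fintype.card F - 2 + 1 := by
    have : 1 < Fintype.card F := Fintype.one_lt_card
    omega
  rw [hdet]
  apply mul_left_cancel₀ (moore_ne_zero F hv)
  rw [hq, pow_succ] at hfin
  linear_combination hfin

/-- A cyclic rotation of the rows, without sign in characteristic 2, gives the row order `v, Dv,
v^q, …` used in the Pfaffian expansion. -/
theorem derivation_dicksonPoly_coeff_rotate (D : Derivation F R R) {N : ℕ} (hN : 2 ≤ N)
    {v : Fin N → R} (hv : LinearIndependent F v) :
    D ((dicksonPoly F v).coeff (Fintype.card F ^ (N - 1))) = moore F v ^ (Fintype.card F - 2) *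
      Matrix.det (Matrix.of fun (i : Fin N) j =>
        if (i : ℕ) = 0 then v j else if (i : ℕ) = 1 then D (v j)
          else v j ^ Fintype.card F ^ (i - 1 : ℕ)) := by
  obtain ⟨n, rfl⟩ : ∃ n, N = n + 1 := ⟨N - 1, by omega⟩
  rw [Nat.add_sub_cancel, derivation_dicksonPoly_coeff D (by omega) hv]
  refine congrArg₂ (· * ·) rfl ?_
  set M : Matrix (Fin (n + 1)) (Fin (n + 1)) R := Matrix.of fun i j =>
    if (i : ℕ) = 0 then v j else if (i : ℕ) = 1 then D (v j)
      else v j ^ Fintype.card F ^ (i - 1 : ℕ) with hM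
  have hperm : (M.submatrix (finRotate (n + 1)) id).det = M.det := by
    rw [Matrix.det_permute]
    rcases Int.units_eq_one_or (Equiv.Perm.sign (finRotate (n + 1))) with h | h <;>
      simp [h, CharTwo.neg_eq]
  rw [← hperm]
  refine congrArg Matrix.det ?_
  ext i j
  rw [Matrix.submatrix_apply, hM, Matrix.of_apply, Matrix.of_apply, id]
  by_cases hl : i = Fin.last n
  · rw [hl, finRotate_last, if_neg, if_pos rfl]
    · simp
    · intro h
      have := congrArg Fin.val h
      simp at this
      omega
  · have hr : (finRotate (n + 1) i : ℕ) = i + 1 := coe_finRotate_of_ne_last hl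
    rw [hr, if_neg (Nat.succ_ne_zero _), if_neg hl]
    by_cases hi : i = 0
    · simp [hi]
    · have hi' : (i : ℕ) ≠ 0 := fun h => hi (Fin.ext h)
      rw [if_neg hi, if_neg (by omega), Nat.add_sub_cancel]

end Derivation

/-! ### Existence and uniqueness of `b₁`. -/

section SquareRoot

set_option linter.unusedSectionVars false

variable (F : Type*) [Field F] [Fintype F] [CharP F 2]

variable {F} {m : ℕ} (D : Derivation F (Sz F m) (Sz F m))

theorem derivation_xi {k : ℕ} (hk : 1 ≤ k) :
    D (xi F m k) = form (fun j => D (w F m j)) (row F m k) := by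
  rw [xi_eq_form F m hk, form, map_sum, form]
  refine Finset.sum_congr rfl fun j _ => ?_
  rw [Derivation.leibniz, row, row, derivation_pow_card D _ hk, smul_zero, zero_add, pow_zero,
    pow_one, smul_eq_mul, mul_comm]

theorem derivation_xiBar :
    D (xiBar F m) = form (fun j => D (w F m j)) (row F m 0) := by
  rw [xiBar, map_sum, form_eq_sum]
  refine Finset.sum_congr rfl fun j _ => ?_
  rw [row_castAdd, row_natAdd, w_castAdd, w_natAdd, Fin.rev_rev, pow_zero, pow_one, pow_one,
    Derivation.leibniz, smul_eq_mul, smul_eq_mul]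
  ring

/-- With the index 0 absent, every Gram entry is a `q`-th power. -/
theorem derivation_xiPf {I : Finset ℕ} (hI : ∀ k ∈ I, 1 ≤ k) : D (xiPf F m I) = 0 := by
  classical
  rw [xiPf, pf, map_sum]
  refine Finset.sum_eq_zero fun T hT => derivation_prod_eq_zero _ _ _ fun p hp => ?_
  exact derivation_pow_card D _ (hI _ ((Finset.mem_filter.1 hT).2.mem hp).1)

/-- The sequence `w, e, w^q, w^(q^2), …` of vectors. -/
def bordered (e : Fin (m + m) → Sz F m) : ℕ → Fin (m + m) → Sz F m
  | 0 => row F m 0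
  | 1 => e
  | k + 2 => row F m (k + 1)

theorem pf_bordered (e : Fin (m + m) → Sz F m) {I : Finset ℕ} (hI : ∀ k ∈ I, 1 ≤ k) :
    pf (fun i j => form (bordered e i) (bordered e j))
      (I.map (OrderEmbedding.addRight 1).toEmbedding) = xiPf F m I := by
  rw [pf_map, xiPf]
  refine pf_congr fun k hk l hl hkl => ?_
  obtain ⟨k, rfl⟩ := Nat.exists_eq_add_of_le' (hI k hk)
  obtain ⟨l, rfl⟩ := Nat.exists_eq_add_of_le' (hI l hl)
  exact form_row F m hkl

/-- Expand the Pfaffian along `w`: either `w` is matched with `e`, or `w` is matched with a twist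
`k` and then `e` with another twist `l`. -/
theorem det_bordered (hm : 1 ≤ m) (e : Fin (m + m) → Sz F m) :
    Matrix.det (Matrix.of fun i j : Fin (m + m) => bordered e i j) =
      form e (row F m 0) * xiPf F m (Finset.Icc 1 (2 * m - 2)) +
      ∑ k ∈ Finset.Icc 1 (2 * m - 2), ∑ l ∈ (Finset.Icc 1 (2 * m - 2)).erase k,
        xi F m k * form e (row F m l) *
          xiPf F m (((Finset.Icc 1 (2 * m - 2)).erase k).erase l) := by
  classical
  rw [← pf_form_eq_det]
  set K := Finset.Icc 1 (2 * m - 2) with hK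
  have hK1 : ∀ k ∈ K, 1 ≤ k := fun k hk => (Finset.mem_Icc.1 hk).1
  let s : ℕ ↪ ℕ := (OrderEmbedding.addRight 1).toEmbedding
  have hs : ∀ k, s k = k + 1 := fun k => rfl
  have hr : Finset.range (m + m) = insert 0 (insert 1 (K.map s)) := by
    ext k
    simp only [Finset.mem_range, Finset.mem_insert, Finset.mem_map, hs, hK, Finset.mem_Icc]
    constructor
    · intro h
      rcases k with _ | _ | k
      · simp
      · simp
      · exact Or.inr (Or.inr ⟨k + 1, by omega, rfl⟩)
    · rintro (h | h | ⟨a, ha, rfl⟩) <;> omega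
  have h1 : ∀ J ⊆ K, ∀ j ∈ J.map s, 1 < j := by
    intro J hJ j hj
    obtain ⟨a, ha, rfl⟩ := Finset.mem_map.1 hj
    have := hK1 a (hJ ha)
    rw [hs]
    omega
  have h1n : (1 : ℕ) ∉ K.map s := fun h => lt_irrefl _ (h1 K subset_rfl 1 h)
  have hb : ∀ k, 1 ≤ k → bordered e (k + 1) = row F m k := by
    intro k hk
    obtain ⟨k, rfl⟩ := Nat.exists_eq_add_of_le' hk
    rfl
  rw [hr, pf_insert, Finset.sum_insert h1n, Finset.erase_insert h1n, pf_bordered e hK1]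
  · refine congrArg₂ (· + ·) (congrArg₂ (· * ·) (form_comm _ _) rfl) ?_
    · rw [Finset.sum_map]
      refine Finset.sum_congr rfl fun k hk => ?_
      have hne : (1 : ℕ) ≠ s k := by
        have := hK1 k hk
        rw [hs]
        omega
      rw [Finset.erase_insert_of_ne hne, ← Finset.map_erase,
        pf_insert _ (h1 _ (Finset.erase_subset _ _)), Finset.sum_map, Finset.mul_sum]
      refine Finset.sum_congr rfl fun l hl => ?_
      rw [← Finset.map_erase, pf_bordered e, hs, hs, hb k (hK1 k hk),
        hb l (hK1 l (Finset.mem_of_mem_erase hl)), xi_eq_form F m (hK1 k hk), mul_assoc]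
      · rfl
      · intro j hj
        exact hK1 j (Finset.mem_of_mem_erase (Finset.mem_of_mem_erase hj))
  · intro j hj
    rcases Finset.mem_insert.1 hj with rfl | hj
    · exact Nat.zero_lt_one
    · exact (h1 K subset_rfl j hj).trans' Nat.zero_lt_one

theorem sum_sum_erase_eq {A : Type*} [AddCommMonoid A] (N : ℕ) (g : ℕ → ℕ → A) :
    ∑ k ∈ Finset.Ico 1 N, ∑ l ∈ (Finset.Ico 1 N).erase k, g k l =
      ∑ k ∈ Finset.Ico 1 N, ∑ j ∈ Finset.Ico 1 k, (g j k + g k j) := by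
  have h1 : ∀ k ∈ Finset.Ico 1 N, ∑ l ∈ (Finset.Ico 1 N).erase k, g k l =
      ∑ l ∈ Finset.Ico (k + 1) N, g k l + ∑ l ∈ Finset.Ico 1 k, g k l := by
    intro k hk
    rw [Finset.mem_Ico] at hk
    rw [← Finset.sum_union]
    · refine Finset.sum_congr ?_ fun _ _ => rfl
      ext l
      simp only [Finset.mem_erase, Finset.mem_union, Finset.mem_Ico]
      omega
    · rw [Finset.disjoint_left]
      intro l hl
      simp only [Finset.mem_Ico] at hl ⊢
      omega
  rw [Finset.sum_congr rfl h1, Finset.sum_add_distrib]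
  simp only [Finset.sum_add_distrib]
  congr 1
  refine Finset.sum_comm' fun k l => ?_
  simp only [Finset.mem_Ico]
  omega

/-- The `ξ̄₀` summand yields the matchings joining `w` to `Dw`. In `ξ_j ξ_k δ_{jk}` only the first
two factors are differentiated, giving the two ways to match `w` and `Dw` with the twists `j` and
`k`. -/
theorem derivation_deltaOne_add (hm : 1 ≤ m) :
    D (deltaOne F m + xiBar F m * uPrev F m ^ Fintype.card F) =
      Matrix.det (Matrix.of fun i j : Fin (m + m) => bordered (fun j => D (w F m j)) i j) := by
  have hK : Finset.Icc 1 (2 * m - 2) = Finset.Ico 1 (2 * m - 1) := by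
    ext k
    simp only [Finset.mem_Icc, Finset.mem_Ico]
    omega
  have hI : ∀ k ∈ Finset.Icc 1 (2 * m - 2), 1 ≤ k := fun k hk => (Finset.mem_Icc.1 hk).1
  rw [det_bordered hm, map_add, add_comm, Derivation.leibniz, uPrev_pow_eq_xiPf,
    derivation_xiPf D hI, smul_zero, zero_add, derivation_xiBar, smul_eq_mul, mul_comm]
  congr 1
  rw [deltaOne, map_sum, hK, sum_sum_erase_eq]
  refine Finset.sum_congr rfl fun k hk => ?_
  rw [map_sum]
  refine Finset.sum_congr rfl fun j hj => ?_
  rw [Finset.mem_Ico] at hk hj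
  have h0 : D (xiPf F m (((Finset.Icc 1 (2 * m - 2)).erase j).erase k)) = 0 :=
    derivation_xiPf D fun i hi => hI i (Finset.mem_of_mem_erase (Finset.mem_of_mem_erase hi))
  rw [deltaPair_eq_xiPf F m hj.1 hj.2 hk.2, Derivation.leibniz, h0, smul_zero, zero_add,
    Derivation.leibniz, derivation_xi D hj.1, derivation_xi D hk.1,
    Finset.erase_right_comm (a := k) (b := j), hK]
  simp only [smul_eq_mul]
  ring

theorem derivation_dickson_one (hm : 1 ≤ m) :
    D (dickson F m 1) = u F m ^ (Fintype.card F - 2) *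
      Matrix.det (Matrix.of fun i j : Fin (m + m) => bordered (fun j => D (w F m j)) i j) := by
  have h := derivation_dicksonPoly_coeff_rotate D (show 2 ≤ m + m by omega)
    (linearIndependent_w F m)
  rw [dickson_eq_coeff, u_eq_moore, show 2 * m - 1 = m + m - 1 by omega, h]
  refine congrArg₂ (· * ·) rfl (congrArg Matrix.det ?_)
  ext1 i j
  rw [Matrix.of_apply, Matrix.of_apply]
  rcases hi : (i : ℕ) with _ | _ | k
  · rw [if_pos rfl, bordered, row, pow_zero, pow_one]
  · rfl
  · rfl

theorem derivation_bOneSq (hm : 1 ≤ m) : D (bOneSq F m) = 0 := by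
  have hu : D (u F m ^ (Fintype.card F - 2)) = 0 :=
    derivation_pow_even D _ (Nat.dvd_sub two_dvd_card dvd_rfl)
  rw [bOneSq, map_add, Derivation.leibniz, hu, smul_zero, add_zero, smul_eq_mul,
    derivation_deltaOne_add D hm, derivation_dickson_one D hm, CharTwo.add_self_eq_zero]

theorem existsUnique_sq_eq_bOneSq (hm : 1 ≤ m) : ∃! b : Sz F m, b ^ 2 = bOneSq F m := by
  obtain ⟨b, hb⟩ := exists_sq_eq_of_pderiv_eq_zero (bOneSq F m)
    fun i => derivation_bOneSq (pderiv i) hm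
  exact ⟨b, hb, fun c hc => CharTwo.sq_inj.1 (hc.trans hb.symm)⟩

end SquareRoot

/-! ### Steenrod operations on Dickson invariants. -/

section SteenrodDickson

variable {F : Type*} [Field F] [Fintype F] [CharP F 2] {R : Type*} [CommRing R] [Algebra F R]
  [CharP R 2] [IsDomain R]

/-- The action of the Steenrod operations on Dickson invariants. -/
theorem coeff_steenrod_dicksonPoly {n : ℕ} {v : Fin n → R} (hv : LinearIndependent F v)
    (Φ : R →ₐ[F] Polynomial R) (h0 : ∀ r, (Φ r).coeff 0 = r)
    (hΦ : ∀ j, Φ (v j) = Polynomial.C (v j) + Polynomial.C (v j ^ Fintype.card F) * Polynomial.X)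
    {j : ℕ} (hj : 1 ≤ j) (hjn : j < n) :
    (Φ ((dicksonPoly F v).coeff (Fintype.card F ^ j))).coeff (Fintype.card F ^ (j - 1)) =
      (dicksonPoly F v).coeff (Fintype.card F ^ (j - 1)) := by
  set q := Fintype.card F with hq
  have hq1 : 1 < q := Fintype.one_lt_card
  set c := fun k : ℕ => (dicksonPoly F v).coeff (q ^ k) with hc
  have hcn : c n = 1 := by
    rw [hc]
    dsimp only
    rw [← natDegree_dicksonPoly F v]
    exact monic_dicksonPoly F v
  let s : Polynomial R := Polynomial.X
  let V : Fin n → ℕ → Polynomial R := fun l k => Polynomial.C (v l) ^ q ^ k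
  have hrel : ∀ l, ∑ k ∈ Finset.range (n + 1), c k * v l ^ q ^ k = 0 := by
    intro l
    rw [Finset.sum_range_succ, hcn, one_mul, pow_card_eq_sum hv l, Finset.sum_range,
      CharTwo.add_self_eq_zero]
  have hΦV : ∀ l k, Φ (v l) ^ q ^ k = V l k + s ^ q ^ k * V l (k + 1) := by
    intro l k
    rw [hΦ, ← frobPow_apply F k, map_add, map_mul, frobPow_apply, frobPow_apply, frobPow_apply,
      Polynomial.C_pow, ← pow_mul, ← pow_succ', mul_comm]
  -- Applying `Φ` to `∑ c_k v^(q^k) = 0` introduces the twist `n + 1`. Adding `s^(q^n)` times the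
  -- Frobenius of the relation removes it, since `c_n = 1`; `d` collects the shifted coefficients.
  let d : ℕ → Polynomial R := fun k =>
    s ^ q ^ k * Φ (c k) + s ^ q ^ n * Polynomial.C (c k) ^ q
  have hdn : d n = 0 := by
    simp only [d, hcn, map_one, one_pow, mul_one]
    exact CharTwo.add_self_eq_zero _
  let d' : ℕ → Polynomial R := fun k => if k = 0 then 0 else d (k - 1)
  let b : Polynomial R := Φ (c n) + d' n
  have hE1 : ∀ l, ∑ k ∈ Finset.range (n + 1), (Φ (c k) * V l k + s ^ q ^ k * Φ (c k) * V l (k + 1))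
      = 0 := by
    intro l
    have h := congrArg Φ (hrel l)
    rw [map_sum, map_zero] at h
    rw [← h]
    refine Finset.sum_congr rfl fun k _ => ?_
    rw [map_mul, map_pow, hΦV]
    ring
  have hE2 : ∀ l, ∑ k ∈ Finset.range (n + 1), Polynomial.C (c k) * V l k = 0 := by
    intro l
    have h := congrArg (Polynomial.C : R →+* Polynomial R) (hrel l)
    rw [map_sum, map_zero] at h
    rw [← h]
    refine Finset.sum_congr rfl fun k _ => ?_
    rw [map_mul, map_pow]
  have hE3 : ∀ l, ∑ k ∈ Finset.range (n + 1), Polynomial.C (c k) ^ q * V l (k + 1) = 0 := by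
    intro l
    have h := congrArg (frobPow F (Polynomial R) 1) (hE2 l)
    rw [map_sum, map_zero] at h
    rw [← h]
    refine Finset.sum_congr rfl fun k _ => ?_
    rw [map_mul, frobPow_apply, frobPow_apply, ← pow_mul, pow_one, ← pow_succ]
  have hshift : ∀ l, ∑ k ∈ Finset.range (n + 1), d k * V l (k + 1) =
      ∑ k ∈ Finset.range (n + 1), d' k * V l k := by
    intro l
    rw [Finset.sum_range_succ, hdn, zero_mul, add_zero, Finset.sum_range_succ']
    simp [d']
  -- Adding `b` times the original relation removes the twist `n` too. The remaining relation among
  -- the twists `0, …, n-1` is trivial because the Moore determinant is nonzero.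
  let g : ℕ → Polynomial R := fun k => Φ (c k) + d' k + b * Polynomial.C (c k)
  have hgn : g n = 0 := by
    simp only [g, b, hcn, map_one, mul_one]
    exact CharTwo.add_self_eq_zero _
  have hG : ∀ l, ∑ k ∈ Finset.range n, g k * V l k = 0 := by
    intro l
    have h1 : ∑ k ∈ Finset.range n, g k * V l k = ∑ k ∈ Finset.range (n + 1), g k * V l k := by
      rw [Finset.sum_range_succ, hgn, zero_mul, add_zero]
    have h2 : ∑ k ∈ Finset.range (n + 1), g k * V l k =
        ∑ k ∈ Finset.range (n + 1), Φ (c k) * V l k +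
        ∑ k ∈ Finset.range (n + 1), d' k * V l k +
        b * ∑ k ∈ Finset.range (n + 1), Polynomial.C (c k) * V l k := by
      rw [Finset.mul_sum, ← Finset.sum_add_distrib, ← Finset.sum_add_distrib]
      refine Finset.sum_congr rfl fun k _ => ?_
      simp only [g]
      ring
    have h3 : ∑ k ∈ Finset.range (n + 1), d k * V l (k + 1) =
        ∑ k ∈ Finset.range (n + 1), s ^ q ^ k * Φ (c k) * V l (k + 1) +
        s ^ q ^ n * ∑ k ∈ Finset.range (n + 1), Polynomial.C (c k) ^ q * V l (k + 1) := by
      rw [Finset.mul_sum, ← Finset.sum_add_distrib]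
      refine Finset.sum_congr rfl fun k _ => ?_
      simp only [d]
      ring
    have h4 := hE1 l
    rw [Finset.sum_add_distrib] at h4
    rw [h1, h2, hE2, mul_zero, add_zero, ← hshift, h3, hE3, mul_zero, add_zero, h4]
  have hg0 : g j = 0 := by
    have hdet : Matrix.det (Matrix.of fun (i : Fin n) l => V l i) ≠ 0 := by
      have h1 := map_moore F (Polynomial.C : R →+* Polynomial R) v
      intro h2
      refine moore_ne_zero F hv (Polynomial.C_injective ?_)
      rw [h1, map_zero, ← h2]
      rfl
    have h3 := Matrix.eq_zero_of_vecMul_eq_zero hdet (v := fun i : Fin n => g i) (by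
      ext1 l
      rw [Matrix.vecMul, dotProduct, Pi.zero_apply, ← hG l, Finset.sum_range]
      rfl)
    exact congrFun h3 ⟨j, hjn⟩
  have hcoef := congrArg (fun p => Polynomial.coeff p (q ^ (j - 1))) hg0
  have hlt1 : q ^ (j - 1) < q ^ (n - 1) := Nat.pow_lt_pow_right hq1 (by omega)
  have hlt2 : q ^ (j - 1) < q ^ n := Nat.pow_lt_pow_right hq1 (by omega)
  have hpos : 0 < q ^ (j - 1) := pow_pos (by omega) _
  have hlow : ∀ (k : ℕ) (p : Polynomial R), q ^ (j - 1) < k →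
      (s ^ k * p).coeff (q ^ (j - 1)) = 0 := by
    intro k p hk
    rw [Polynomial.coeff_X_pow_mul', if_neg (by omega)]
  -- Apart from its constant 1, `b` has only terms of degree at least `q^(n-1)`, which exceeds
  -- `q^(j-1)`.
  have hb : b.coeff (q ^ (j - 1)) = 0 := by
    simp only [b, d', d, if_neg (show n ≠ 0 by omega), hcn, map_one, Polynomial.coeff_add,
      hlow _ _ hlt1, hlow _ _ hlt2, Polynomial.coeff_one, if_neg hpos.ne', add_zero]
  simp only [g, d', d, if_neg (show j ≠ 0 by omega), Polynomial.coeff_add, Polynomial.coeff_mul_C,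
    hb, hlow _ _ hlt2, zero_mul, add_zero, Polynomial.coeff_zero] at hcoef
  have hlast : (s ^ q ^ (j - 1) * Φ (c (j - 1))).coeff (q ^ (j - 1)) = c (j - 1) := by
    rw [Polynomial.coeff_X_pow_mul', if_pos le_rfl, Nat.sub_self, h0]
  rw [hlast] at hcoef
  exact CharTwo.add_eq_zero.1 hcoef

end SteenrodDickson

/-! ### Steenrod operations: substitutions and degrees. -/

section Steenrod

set_option linter.unusedSectionVars false

variable {F : Type*} [Field F] [Fintype F] {m : ℕ}

theorem steenrodTotal_X (i : Var m) : steenrodTotal F m (X i) =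
    Polynomial.C (X i) + Polynomial.C (X i ^ Fintype.card F) * Polynomial.X := by
  rw [steenrodTotal, aeval_X]

theorem steenrodTotal_w (j : Fin (m + m)) : steenrodTotal F m (w F m j) =
    Polynomial.C (w F m j) + Polynomial.C (w F m j ^ Fintype.card F) * Polynomial.X := by
  rw [w_eq_X, steenrodTotal_X]

theorem steenrod_zero (f : Sz F m) : steenrod F m 0 f = f := by
  have h : ∀ f : Sz F m, Polynomial.constantCoeff (steenrodTotal F m f) = f := by
    intro f
    induction f using MvPolynomial.induction_on with
    | C a =>
      rw [← MvPolynomial.algebraMap_eq, AlgHom.commutes]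
      simp [Polynomial.algebraMap_apply]
    | add p q hp hq => rw [map_add, map_add, hp, hq]
    | mul_X p i hp => rw [map_mul, map_mul, hp, steenrodTotal_X]; simp
  exact h f

theorem steenrod_add (k : ℕ) (f g : Sz F m) :
    steenrod F m k (f + g) = steenrod F m k f + steenrod F m k g := by
  rw [steenrod, map_add, Polynomial.coeff_add, steenrod, steenrod]

/-- Two algebra homomorphisms that agree on variables, because the `q`-power map is `F`-linear. -/
theorem steenrodTotal_subst (g : Matrix (Var m) (Var m) F) (f : Sz F m) :
    steenrodTotal F m (subst g f) = (steenrodTotal F m f).map (subst g).toRingHom := by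
  have h : (steenrodTotal F m).comp (subst g) =
      (Polynomial.mapAlgHom (subst g)).comp (steenrodTotal F m) := by
    apply MvPolynomial.algHom_ext
    intro i
    have hs : subst g (X i) = ∑ j, g i j • (X j : Sz F m) := by
      rw [subst, aeval_X]
      simp only [smul_eq_C_mul]
    have hp : subst g (X i) ^ Fintype.card F = ∑ j, g i j • (X j : Sz F m) ^ Fintype.card F := by
      rw [hs]
      simpa using sum_smul_pow_card F (g i) (fun j => (X j : Sz F m)) 1
    rw [AlgHom.comp_apply, AlgHom.comp_apply, steenrodTotal_X, map_add, map_mul]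
    simp only [Polynomial.coe_mapAlgHom, Polynomial.map_C, Polynomial.map_X, RingHom.coe_coe,
      map_pow (subst g)]
    rw [hp, hs, map_sum, map_sum, map_sum, Finset.sum_mul, ← Finset.sum_add_distrib]
    refine Finset.sum_congr rfl fun j _ => ?_
    rw [map_smul, steenrodTotal_X, smul_add, ← Polynomial.smul_C, ← Polynomial.smul_C,
      smul_mul_assoc]
  exact DFunLike.congr_fun h f

theorem steenrod_subst (g : Matrix (Var m) (Var m) F) (k : ℕ) (f : Sz F m) :
    steenrod F m k (subst g f) = subst g (steenrod F m k f) := by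
  rw [steenrod, steenrodTotal_subst, Polynomial.coeff_map, steenrod]
  rfl

theorem coeff_mul_isHomogeneous {σ : Type*} {e d d' : ℕ} {p p' : Polynomial (MvPolynomial σ F)}
    (hp : ∀ k, (p.coeff k).IsHomogeneous (d + k * e))
    (hp' : ∀ k, (p'.coeff k).IsHomogeneous (d' + k * e)) (k : ℕ) :
    ((p * p').coeff k).IsHomogeneous (d + d' + k * e) := by
  rw [Polynomial.coeff_mul]
  refine IsHomogeneous.sum _ _ _ fun x hx => ?_
  have h := (hp x.1).mul (hp' x.2)
  rw [Finset.HasAntidiagonal.mem_antidiagonal] at hx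
  have h2 : d + x.1 * e + (d' + x.2 * e) = d + d' + k * e := by rw [← hx]; ring
  rwa [h2] at h

/-- The degree of the coefficient of `t^k` rises by `k(q-1)`; this property is multiplicative, so
variables and constants suffice. -/
theorem isHomogeneous_steenrod {f : Sz F m} {d : ℕ} (hf : f.IsHomogeneous d) (k : ℕ) :
    (steenrod F m k f).IsHomogeneous (d + k * (Fintype.card F - 1)) := by
  have hC : ∀ (r : F) (k : ℕ), ((steenrodTotal F m (C r)).coeff k).IsHomogeneous
      (0 + k * (Fintype.card F - 1)) := by
    intro r k
    rw [← MvPolynomial.algebraMap_eq, AlgHom.commutes, Polynomial.algebraMap_apply,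
      Polynomial.coeff_C]
    split_ifs with hk
    · rw [hk, zero_mul, add_zero]
      exact isHomogeneous_C _ _
    · exact isHomogeneous_zero _ _ _
  have hX : ∀ (i : Var m) (k : ℕ), ((steenrodTotal F m (X i)).coeff k).IsHomogeneous
      (1 + k * (Fintype.card F - 1)) := by
    intro i k
    rw [steenrodTotal_X, Polynomial.coeff_add, Polynomial.coeff_C, Polynomial.coeff_C_mul,
      Polynomial.coeff_X]
    rcases k with _ | _ | k
    · simpa using isHomogeneous_X F i
    · have hq : 1 + (0 + 1) * (Fintype.card F - 1) = Fintype.card F := by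
        have : 0 < Fintype.card F := Fintype.card_pos
        omega
      rw [hq]
      simpa using isHomogeneous_X_pow (R := F) i (Fintype.card F)
    · simpa using isHomogeneous_zero _ _ _
  have hpow : ∀ (i : Var m) (n k : ℕ), ((steenrodTotal F m (X i) ^ n).coeff k).IsHomogeneous
      (n + k * (Fintype.card F - 1)) := by
    intro i n
    induction n with
    | zero =>
      intro k
      have := hC 1 k
      rwa [C_1, map_one] at this
    | succ n ih =>
      rw [pow_succ]
      exact coeff_mul_isHomogeneous ih (hX i)
  have hprod : ∀ (a : Var m →₀ ℕ) (s : Finset (Var m)) (k : ℕ),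
      ((∏ i ∈ s, steenrodTotal F m (X i) ^ a i).coeff k).IsHomogeneous
      (∑ i ∈ s, a i + k * (Fintype.card F - 1)) := by
    classical
    intro a s
    induction s using Finset.induction_on with
    | empty =>
      intro k
      have := hC 1 k
      rwa [C_1, map_one] at this
    | insert i s hi ih =>
      rw [Finset.prod_insert hi, Finset.sum_insert hi]
      exact coeff_mul_isHomogeneous (hpow i _) ih
  rw [steenrod, f.as_sum, map_sum, Polynomial.finsetSum_coeff]
  refine IsHomogeneous.sum _ _ _ fun a ha => ?_
  have hdeg : a.degree = d := by
    by_contra h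
    exact (mem_support_iff.1 ha) (hf.coeff_eq_zero h)
  rw [monomial_eq, map_mul, Finsupp.prod, map_prod]
  simp only [map_pow]
  have h := coeff_mul_isHomogeneous (hC (coeff a f)) (hprod a a.support) k
  have hsum : ∑ i ∈ a.support, a i = d := hdeg
  rwa [zero_add, hsum] at h

end Steenrod

/-! ### Steenrod operations: squares, the `ξ`'s and their ideal. -/

section Steenrod

set_option linter.unusedSectionVars false

variable {F : Type*} [Field F] [Fintype F] [CharP F 2] {m : ℕ}

/-- The total operation is multiplicative, and squaring a polynomial in `t` squares each coefficient
and doubles its exponent. This gives access to the `e_i` through their squares. -/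
theorem steenrod_sq (k : ℕ) (f : Sz F m) :
    steenrod F m k f ^ 2 = steenrod F m (2 * k) (f ^ 2) := by
  have : ExpChar (Sz F m) 2 := ExpChar.prime Nat.prime_two
  rw [steenrod, steenrod, map_pow, ← Polynomial.map_frobenius_expand (p := 2), Polynomial.coeff_map,
    Polynomial.coeff_expand_mul' two_pos, frobenius_def]

theorem steenrodTotal_row (k : ℕ) (j : Fin (m + m)) : steenrodTotal F m (row F m k j) =
    Polynomial.C (row F m k j) +
      Polynomial.C (row F m (k + 1) j) * Polynomial.X ^ Fintype.card F ^ k := by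
  rw [row, map_pow, steenrodTotal_w, ← frobPow_apply F k, map_add, map_mul, frobPow_apply,
    frobPow_apply, frobPow_apply, ← Polynomial.C_pow, ← Polynomial.C_pow, ← pow_mul, ← pow_succ']
  rfl

theorem steenrodTotal_form_row (k : ℕ) :
    steenrodTotal F m (form (row F m 0) (row F m k)) =
      Polynomial.C (form (row F m 0) (row F m k)) +
      Polynomial.C (form (row F m 1) (row F m k)) * Polynomial.X +
      Polynomial.C (form (row F m 0) (row F m (k + 1))) * Polynomial.X ^ Fintype.card F ^ k +
      Polynomial.C (form (row F m 1) (row F m (k + 1))) *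
        Polynomial.X ^ (Fintype.card F ^ k + 1) := by
  simp only [form, map_sum, Finset.sum_mul, ← Finset.sum_add_distrib]
  refine Finset.sum_congr rfl fun j _ => ?_
  rw [map_mul, steenrodTotal_row, steenrodTotal_row, pow_zero, pow_one]
  simp only [map_mul]
  ring

theorem steenrodTotal_xiZero :
    steenrodTotal F m (xi F m 0) = Polynomial.C (xi F m 0) +
      Polynomial.C (xi F m 1) * Polynomial.X +
      Polynomial.C (xi F m 0 ^ Fintype.card F) * Polynomial.X ^ 2 := by
  have hfrob : xiBar F m ^ Fintype.card F =
      ∑ j, x F m j ^ Fintype.card F * y F m j ^ Fintype.card F := by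
    have h := map_sum (frobPow F (Sz F m) 1) (fun j => x F m j * y F m j) Finset.univ
    simp only [frobPow_apply, pow_one, mul_pow] at h
    exact h
  have hbar : steenrodTotal F m (xiBar F m) = Polynomial.C (xiBar F m) +
      Polynomial.C (xi F m 1) * Polynomial.X +
      Polynomial.C (xiBar F m ^ Fintype.card F) * Polynomial.X ^ 2 := by
    rw [hfrob, xi_succ F m 0, xiBar]
    simp only [map_sum, Finset.sum_mul, ← Finset.sum_add_distrib]
    refine Finset.sum_congr rfl fun j _ => ?_
    rw [map_mul, x, y, steenrodTotal_X, steenrodTotal_X, zero_add, pow_one]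
    simp only [map_mul, map_add]
    ring
  have hz : steenrodTotal F m (z F m ^ 2) = Polynomial.C (z F m ^ 2) +
      Polynomial.C ((z F m ^ 2) ^ Fintype.card F) * Polynomial.X ^ 2 := by
    rw [map_pow, z, steenrodTotal_X, CharTwo.add_sq, mul_pow, ← Polynomial.C_pow,
      ← Polynomial.C_pow, ← pow_mul, ← pow_mul, mul_comm 2]
  have h0 : (z F m ^ 2 + xiBar F m) ^ Fintype.card F =
      (z F m ^ 2) ^ Fintype.card F + xiBar F m ^ Fintype.card F := by
    have h := map_add (frobPow F (Sz F m) 1) (z F m ^ 2) (xiBar F m)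
    simpa only [frobPow_apply, pow_one] using h
  change steenrodTotal F m (z F m ^ 2 + xiBar F m) = Polynomial.C (z F m ^ 2 + xiBar F m) + _ +
    Polynomial.C ((z F m ^ 2 + xiBar F m) ^ Fintype.card F) * _
  rw [map_add, hz, hbar, h0]
  simp only [map_add]
  ring

theorem steenrod_xi (k : ℕ) : steenrod F m (Fintype.card F ^ k) (xi F m k) = xi F m (k + 1) := by
  have hq : 1 < Fintype.card F := Fintype.one_lt_card
  rcases k with _ | k
  · rw [steenrod, steenrodTotal_xiZero, pow_zero]
    simp only [Polynomial.coeff_add, Polynomial.coeff_C_mul, Polynomial.coeff_X_pow,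
      Polynomial.coeff_C, Polynomial.coeff_X]
    simp
  · have h1 : 1 < Fintype.card F ^ (k + 1) := Nat.one_lt_pow (by omega) hq
    rw [xi_eq_form F m (show 1 ≤ k + 1 by omega), xi_eq_form F m (show 1 ≤ k + 1 + 1 by omega),
      steenrod, steenrodTotal_form_row]
    simp only [Polynomial.coeff_add, Polynomial.coeff_C_mul, Polynomial.coeff_X_pow,
      Polynomial.coeff_C, Polynomial.coeff_X]
    rw [if_neg (show ¬ Fintype.card F ^ (k + 1) = 0 by omega),
      if_neg (show ¬ 1 = Fintype.card F ^ (k + 1) by omega),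
      if_neg (show ¬ Fintype.card F ^ (k + 1) = Fintype.card F ^ (k + 1) + 1 by omega)]
    simp

variable (F m) in
/-- The ideal generated by all the `ξ`'s. -/
def xiIdeal : Ideal (Sz F m) := Ideal.span (Set.range (xi F m))

theorem xi_mem (k : ℕ) : xi F m k ∈ xiIdeal F m := Ideal.subset_span ⟨k, rfl⟩

theorem form_row_mem (k l : ℕ) (h : k ≤ l) : form (row F m k) (row F m l) ∈ xiIdeal F m := by
  rcases h.eq_or_lt with rfl | h
  · rw [form_self]
    exact Ideal.zero_mem _
  · rw [form_row F m h]
    exact Ideal.pow_mem_of_mem _ (xi_mem _) _ (pow_pos Fintype.card_pos _)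

/-- The total operation sends each generator to a polynomial in `t` with coefficients in the ideal,
and these polynomials form an ideal. -/
theorem steenrod_mem {f : Sz F m} (hf : f ∈ xiIdeal F m) (k : ℕ) :
    steenrod F m k f ∈ xiIdeal F m := by
  have hle : xiIdeal F m ≤ ((xiIdeal F m).map (Polynomial.C : Sz F m →+* _)).comap
      (steenrodTotal F m).toRingHom := by
    rw [xiIdeal, Ideal.span_le, ← xiIdeal]
    rintro _ ⟨k, rfl⟩
    have hC : ∀ r ∈ xiIdeal F m, ∀ p : Polynomial (Sz F m),
        Polynomial.C r * p ∈ (xiIdeal F m).map (Polynomial.C : Sz F m →+* _) :=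
      fun r hr p => Ideal.mul_mem_right _ _ (Ideal.mem_map_of_mem _ hr)
    change steenrodTotal F m (xi F m k) ∈ (xiIdeal F m).map (Polynomial.C : Sz F m →+* _)
    rcases k with _ | k
    · rw [steenrodTotal_xiZero]
      refine Ideal.add_mem _ (Ideal.add_mem _ (Ideal.mem_map_of_mem _ (xi_mem _))
        (hC _ (xi_mem _) _)) (hC _ ?_ _)
      exact Ideal.pow_mem_of_mem _ (xi_mem _) _ Fintype.card_pos
    · rw [xi_eq_form F m (show 1 ≤ k + 1 by omega), steenrodTotal_form_row]
      exact Ideal.add_mem _ (Ideal.add_mem _ (Ideal.add_mem _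
        (Ideal.mem_map_of_mem _ (form_row_mem _ _ (by omega)))
        (hC _ (form_row_mem _ _ (by omega)) _)) (hC _ (form_row_mem _ _ (by omega)) _))
        (hC _ (form_row_mem _ _ (by omega)) _)
  exact Ideal.mem_map_C_iff.1 (hle hf) k

theorem steenrod_dickson {i : ℕ} (hi : 1 ≤ i) (him : i < 2 * m) :
    steenrod F m (Fintype.card F ^ (2 * m - 1 - i)) (dickson F m i) = dickson F m (i + 1) := by
  have h := coeff_steenrod_dicksonPoly (linearIndependent_w F m) (steenrodTotal F m)
    steenrod_zero steenrodTotal_w (j := 2 * m - i) (by omega) (by omega)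
  rw [dickson_eq_coeff, dickson_eq_coeff, steenrod, show 2 * m - 1 - i = 2 * m - i - 1 by omega,
    show 2 * m - (i + 1) = 2 * m - i - 1 by omega, h]

end Steenrod

/-! ### Homogeneity of the parameters. -/

section Homogeneity

set_option linter.unusedSectionVars false

variable {F : Type*} [Field F]

theorem coeff_prod_X_add_C_isHomogeneous {σ ι : Type*} (s : Finset ι) (l : ι → MvPolynomial σ F)
    (hl : ∀ i, (l i).IsHomogeneous 1) (k d : ℕ) (hkd : k + d = s.card) :
    ((∏ i ∈ s, (Polynomial.X + Polynomial.C (l i))).coeff k).IsHomogeneous d := by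
  classical
  induction s using Finset.induction_on generalizing k d with
  | empty =>
    obtain ⟨rfl, rfl⟩ : k = 0 ∧ d = 0 := by simpa using hkd
    simpa using isHomogeneous_one σ F
  | insert i s hi ih =>
    have hdeg : (∏ i ∈ s, (Polynomial.X + Polynomial.C (l i))).natDegree = s.card := by
      rw [Polynomial.natDegree_prod_of_monic _ _ fun _ _ => Polynomial.monic_X_add_C _]
      simp only [Polynomial.natDegree_X_add_C]
      simp
    rw [Finset.card_insert_of_notMem hi] at hkd
    rw [Finset.prod_insert hi, add_mul, Polynomial.coeff_add, Polynomial.coeff_C_mul]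
    refine IsHomogeneous.add ?_ ?_
    · rcases k with _ | k
      · rw [Polynomial.coeff_X_mul_zero]
        exact isHomogeneous_zero _ _ _
      · rw [Polynomial.coeff_X_mul]
        exact ih k d (by omega)
    · rcases d with _ | d
      · rw [Polynomial.coeff_eq_zero_of_natDegree_lt (by omega), mul_zero]
        exact isHomogeneous_zero _ _ _
      · rw [add_comm d 1]
        exact (hl i).mul (ih k d (by omega))

variable [Fintype F] {m : ℕ}

theorem isHomogeneous_dickson (i : ℕ) (hi : i ≤ 2 * m) : (dickson F m i).IsHomogeneous
    (Fintype.card F ^ (2 * m) - Fintype.card F ^ (2 * m - i)) := by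
  rw [dickson_eq_coeff, dicksonPoly]
  apply coeff_prod_X_add_C_isHomogeneous
  · intro a
    refine IsHomogeneous.sum _ _ _ fun j _ => ?_
    rw [smul_eq_C_mul]
    exact (isHomogeneous_w F m j).C_mul _
  · have : Fintype.card F ^ (2 * m - i) ≤ Fintype.card F ^ (2 * m) :=
      Nat.pow_le_pow_right Fintype.card_pos (by omega)
    simp only [Finset.card_univ, Fintype.card_fun, Fintype.card_fin, ← two_mul]
    omega

theorem isHomogeneous_xiZero : (xi F m 0).IsHomogeneous 2 := by
  change (z F m ^ 2 + ∑ j, x F m j * y F m j).IsHomogeneous 2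
  refine IsHomogeneous.add ((isHomogeneous_X F _).pow 2) ?_
  exact IsHomogeneous.sum _ _ _ fun j _ => (isHomogeneous_X F _).mul (isHomogeneous_X F _)

theorem isHomogeneous_deltaOne (hm : 1 ≤ m) : (deltaOne F m).IsHomogeneous
    (2 + ∑ l ∈ Finset.Icc 1 (2 * m - 2), Fintype.card F ^ l) := by
  refine IsHomogeneous.sum _ _ _ fun k hk => IsHomogeneous.sum _ _ _ fun j hj => ?_
  rw [Finset.mem_Ico] at hk hj
  have hj' : j ∈ Finset.Icc 1 (2 * m - 2) := Finset.mem_Icc.2 (by omega)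
  have hk' : k ∈ (Finset.Icc 1 (2 * m - 2)).erase j :=
    Finset.mem_erase.2 ⟨by omega, Finset.mem_Icc.2 (by omega)⟩
  have h := ((isHomogeneous_xi F m j hj.1).mul (isHomogeneous_xi F m k hk.1)).mul
    (isHomogeneous_aeval_natSum (xi F m) (isHomogeneous_xi F m) (2 * m - 2)
    (∑ l ∈ ((Finset.Icc 1 (2 * m - 2)).erase j).erase k, Fintype.card F ^ l) (m - 2))
  have hsum : Fintype.card F ^ j + 1 + (Fintype.card F ^ k + 1) +
      ∑ l ∈ ((Finset.Icc 1 (2 * m - 2)).erase j).erase k, Fintype.card F ^ l =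
      2 + ∑ l ∈ Finset.Icc 1 (2 * m - 2), Fintype.card F ^ l := by
    rw [← Finset.add_sum_erase _ _ hj', ← Finset.add_sum_erase _ _ hk']
    ring
  rwa [hsum] at h

theorem isHomogeneous_uPrev : (uPrev F m).IsHomogeneous
    (∑ l ∈ Finset.range (2 * m - 2), Fintype.card F ^ l) :=
  isHomogeneous_aeval_natSum (xi F m) (isHomogeneous_xi F m) _ _ _

theorem isHomogeneous_u [CharP F 2] : (u F m).IsHomogeneous
    (∑ l ∈ Finset.range (2 * m), Fintype.card F ^ l) := by
  rw [u_eq_aeval]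
  exact isHomogeneous_aeval_natSum (xi F m) (isHomogeneous_xi F m) _ _ _

/-- The square of `e₁`. -/
theorem eInv_zero_sq [CharP F 2] {b : Sz F m} (hb : b ^ 2 = bOneSq F m) :
    eInv m b 0 ^ 2 = dickson F m 1 + u F m ^ (Fintype.card F - 2) *
      (deltaOne F m + xi F m 0 * uPrev F m ^ Fintype.card F) := by
  obtain ⟨t, ht⟩ := two_dvd_card (F := F)
  have h1 : eInv m b 0 =
    u F m ^ (Fintype.card F / 2 - 1) * uPrev F m ^ (Fintype.card F / 2) * z F m + b := rfl
  have h2 : Fintype.card F / 2 = t := by omega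
  have h3 : xi F m 0 = z F m ^ 2 + xiBar F m := rfl
  rw [h1, h2, CharTwo.add_sq, hb, bOneSq, h3, mul_pow, mul_pow, ← pow_mul, ← pow_mul,
    show (t - 1) * 2 = Fintype.card F - 2 by omega, show t * 2 = Fintype.card F by omega]
  ring

theorem isHomogeneous_eInv_zero [CharP F 2] (hm : 1 ≤ m) {b : Sz F m}
    (hb : b ^ 2 = bOneSq F m) : ∃ d, 0 < d ∧ (eInv m b 0).IsHomogeneous d := by
  set q := Fintype.card F with hq
  have hq1 : 1 < q := Fintype.one_lt_card
  obtain ⟨t, ht⟩ := two_dvd_card (F := F)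
  rw [← hq] at ht
  have hlt : q ^ (2 * m - 1) < q ^ (2 * m) := Nat.pow_lt_pow_right hq1 (by omega)
  -- The degree of `e₁` is half that of `d_{1,m}`; the geometric sums below show that the correction
  -- term has the same degree as `d_{1,m}`.
  obtain ⟨d, hd⟩ : 2 ∣ q ^ (2 * m) - q ^ (2 * m - 1) :=
    Nat.dvd_sub (dvd_pow ⟨t, ht⟩ (by omega)) (dvd_pow ⟨t, ht⟩ (by omega))
  refine ⟨d, by omega, isHomogeneous_of_sq ?_⟩
  rw [eInv_zero_sq hb, ← hd]
  refine IsHomogeneous.add (isHomogeneous_dickson 1 (by omega)) ?_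
  have hK' : ∑ l ∈ Finset.range (2 * m - 2), q ^ (l + 1) =
      ∑ l ∈ Finset.Icc 1 (2 * m - 2), q ^ l := by
    rw [Finset.range_eq_Ico, Finset.sum_Ico_add' (fun l => q ^ l) 0 (2 * m - 2) 1]
    rfl
  have hK : (∑ l ∈ Finset.range (2 * m - 2), q ^ l) * q =
      ∑ l ∈ Finset.Icc 1 (2 * m - 2), q ^ l := by
    rw [← hK', Finset.sum_mul]
    exact Finset.sum_congr rfl fun l _ => (pow_succ q l).symm
  have hU : ∑ l ∈ Finset.range (2 * m), q ^ l =
      ∑ l ∈ Finset.Icc 1 (2 * m - 2), q ^ l + 1 + q ^ (2 * m - 1) := by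
    rw [show 2 * m = 2 * m - 2 + 1 + 1 by omega, Finset.sum_range_succ, Finset.sum_range_succ', hK',
      pow_zero, show 2 * m - 2 + 1 + 1 - 2 = 2 * m - 2 by omega,
      show 2 * m - 2 + 1 + 1 - 1 = 2 * m - 2 + 1 by omega]
  have hgeom : (∑ l ∈ Finset.range (2 * m), q ^ l) * (q - 2) +
      ∑ l ∈ Finset.range (2 * m), q ^ l + 1 = q ^ (2 * m) := by
    obtain ⟨r, hr⟩ : ∃ r, q = r + 1 + 1 := ⟨q - 2, by omega⟩
    have h := geom_sum_mul_add (r + 1) (2 * m)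
    rw [← hr] at h
    rw [← h, show q - 2 = r by omega]
    ring
  have h1 := ((isHomogeneous_uPrev (F := F) (m := m)).pow q)
  rw [hK] at h1
  have h2 := ((isHomogeneous_u (F := F) (m := m)).pow (q - 2)).mul
    ((isHomogeneous_deltaOne hm).add (isHomogeneous_xiZero.mul h1))
  have h3 : (∑ l ∈ Finset.range (2 * m), q ^ l) * (q - 2) +
      (2 + ∑ l ∈ Finset.Icc 1 (2 * m - 2), q ^ l) = q ^ (2 * m) - q ^ (2 * m - 1) := by
    omega
  rwa [h3] at h2

theorem isHomogeneous_eInv [CharP F 2] (hm : 1 ≤ m) {b : Sz F m} (hb : b ^ 2 = bOneSq F m)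
    (k : ℕ) : ∃ d, 0 < d ∧ (eInv m b k).IsHomogeneous d := by
  induction k with
  | zero => exact isHomogeneous_eInv_zero hm hb
  | succ k ih =>
    obtain ⟨d, hd, h⟩ := ih
    exact ⟨_, Nat.add_pos_left hd _, isHomogeneous_steenrod h _⟩

end Homogeneity

/-! ### The squares of the `e_i` modulo the `ξ`'s. -/

section Congruence

variable {F : Type*} [Field F] [Fintype F] [CharP F 2] {m : ℕ}

/-- The squared recursion applies `P^(q^(2m-1-i))` to `e_i²`; this operation moves one Dickson
invariant to the next and keeps the error in the ideal. -/
theorem eInv_sq_sub_dickson_mem {b : Sz F m} (hb : b ^ 2 = bOneSq F m) (k : ℕ) (hk : k < m) :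
    ∃ r ∈ xiIdeal F m, eInv m b k ^ 2 = dickson F m (k + 1) + r := by
  induction k with
  | zero =>
    refine ⟨_, ?_, eInv_zero_sq hb⟩
    refine Ideal.mul_mem_left _ _ (Ideal.add_mem _ ?_ (Ideal.mul_mem_right _ _ (xi_mem 0)))
    refine Ideal.sum_mem _ fun k _ => Ideal.sum_mem _ fun j _ => ?_
    exact Ideal.mul_mem_right _ _ (Ideal.mul_mem_right _ _ (xi_mem j))
  | succ k ih =>
    obtain ⟨r, hr, h⟩ := ih (by omega)
    have hdiv : 2 * (Fintype.card F ^ (2 * m - 1 - (k + 1)) / 2) =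
        Fintype.card F ^ (2 * m - 1 - (k + 1)) :=
      Nat.mul_div_cancel' (dvd_pow two_dvd_card (by omega))
    refine ⟨steenrod F m (Fintype.card F ^ (2 * m - 1 - (k + 1))) r, steenrod_mem hr _, ?_⟩
    rw [eInv, steenrod_sq, hdiv, h, steenrod_add, steenrod_dickson (by omega) (by omega)]

end Congruence

/-! ### Invariance under the orthogonal group. -/

section Invariance

set_option linter.unusedSectionVars false

variable {F : Type*} [Field F] [Fintype F] [CharP F 2] {m : ℕ}

theorem subst_injective {g : Matrix.GeneralLinearGroup (Var m) F} :
    Function.Injective (subst g.val) := by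
  intro f f' h
  have h1 := congrArg (subst (g⁻¹).val) h
  rwa [← subst_mul, ← subst_mul, Units.mul_inv, subst_one, AlgHom.id_apply, AlgHom.id_apply] at h1

theorem xi_mem_orthInvariants (k : ℕ) : xi F m k ∈ orthInvariants F m := by
  intro g hg
  induction k with
  | zero => exact hg
  | succ k ih => rw [← steenrod_xi, ← steenrod_subst, ih]

theorem aeval_xi_mem (p : MvPolynomial ℕ F) : aeval (xi F m) p ∈ orthInvariants F m := by
  have h : aeval (xi F m) p ∈ Algebra.adjoin F (Set.range (xi F m)) := by
    rw [Algebra.adjoin_range_eq_range_aeval]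
    exact ⟨p, rfl⟩
  refine Algebra.adjoin_le ?_ h
  rintro _ ⟨k, rfl⟩
  exact xi_mem_orthInvariants k

theorem subst_w (g : Matrix (Var m) (Var m) F) (j : Fin (m + m)) :
    subst g (w F m j) = ∑ k, g (wVar m j) (wVar m k) • w F m k +
      g (wVar m j) (Sum.inr (Sum.inl ())) • z F m := by
  rw [w_eq_X, subst, aeval_X, sum_wVar_add]
  simp only [w_eq_X, z, smul_eq_C_mul]

/-- An orthogonal substitution maps the span of the variables `w` to itself. -/
theorem orthGroup_apply_z {g : Matrix.GeneralLinearGroup (Var m) F} (hg : g ∈ orthGroup F m)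
    (j : Fin (m + m)) : g.val (wVar m j) (Sum.inr (Sum.inl ())) = 0 := by
  classical
  set D : Derivation F (Sz F m) (Sz F m) := pderiv (Sum.inr (Sum.inl ())) with hD
  set a : Fin (m + m) → F := fun j => g.val (wVar m j) (Sum.inr (Sum.inl ())) with ha
  have hDw : ∀ j, D (w F m j) = 0 := fun j => by
    rw [w_eq_X, hD, pderiv_X_of_ne (wVar_ne_z m j)]
  have hDz : D (z F m) = 1 := by rw [hD, z, pderiv_X_self]
  have hDs : ∀ j, D (subst g.val (w F m j)) = C (a j) := by
    intro j
    rw [subst_w, map_add, map_sum, Derivation.map_smul, hDz]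
    simp only [Derivation.map_smul, hDw, smul_zero, Finset.sum_const_zero, zero_add]
    rw [smul_eq_C_mul, mul_one]
  have h1 : D (xi F m 1) = 0 := by
    rw [derivation_xi D le_rfl, form]
    simp [hDw]
  -- Differentiate the invariance of `ξ₁`, which is free of `z`, with respect to `z`. As the `a j`
  -- lie in `F`, the sum is a `q`-th power, so a linear relation among the `w` results.
  have h2 : ∑ j, a j • subst g.val (w F m j.rev) ^ Fintype.card F = 0 := by
    rw [← h1, ← xi_mem_orthInvariants 1 g hg, xi_eq_form F m le_rfl, form, map_sum, map_sum]
    refine Finset.sum_congr rfl fun j _ => ?_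
    rw [map_mul, row, row, map_pow, map_pow, Derivation.leibniz,
      derivation_pow_card D _ le_rfl, smul_zero, zero_add, pow_zero, pow_one, pow_one, hDs,
      smul_eq_mul, mul_comm, smul_eq_C_mul]
  have h3 : subst g.val (∑ j, a j • w F m j.rev) = subst g.val 0 := by
    have h4 := sum_smul_pow_card F a (fun j => subst g.val (w F m j.rev)) 1
    rw [pow_one, h2] at h4
    rw [map_zero, map_sum]
    simp only [map_smul]
    exact pow_eq_zero_iff Fintype.card_ne_zero |>.1 h4
  have h5 := subst_injective h3
  have h6 := Fintype.linearIndependent_iff.1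
    ((linearIndependent_w F m).comp Fin.rev Fin.rev_injective) a h5
  exact h6 j

/-- An orthogonal substitution permutes the linear forms in `w`, hence the factors of `dicksonPoly`.
-/
theorem dickson_mem_orthInvariants (i : ℕ) : dickson F m i ∈ orthInvariants F m := by
  intro g hg
  let h : Matrix (Fin (m + m)) (Fin (m + m)) F := Matrix.of fun j k => g.val (wVar m j) (wVar m k)
  have hw : ∀ a : Fin (m + m) → F, subst g.val (∑ j, a j • w F m j) =
      ∑ k, (Matrix.vecMul a h) k • w F m k := by
    intro a
    rw [map_sum]
    simp only [map_smul, subst_w, orthGroup_apply_z hg, zero_smul, add_zero, Finset.smul_sum,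
      Matrix.vecMul, dotProduct, Finset.sum_smul, smul_smul]
    rw [Finset.sum_comm]
    rfl
  have hinj : Function.Injective fun a : Fin (m + m) → F => Matrix.vecMul a h := by
    intro a b hab
    apply injective_sum_smul F (linearIndependent_w F m)
    apply subst_injective (g := g)
    dsimp only
    rw [hw, hw, show Matrix.vecMul a h = Matrix.vecMul b h from hab]
  have hpoly : (dicksonPoly F (w F m)).map (subst g.val).toRingHom = dicksonPoly F (w F m) := by
    rw [dicksonPoly, Polynomial.map_prod]
    refine Fintype.prod_bijective _ (Finite.injective_iff_bijective.1 hinj) _ _ fun a => ?_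
    rw [Polynomial.map_add, Polynomial.map_X, Polynomial.map_C, ← hw]
    rfl
  rw [dickson_eq_coeff]
  conv_rhs => rw [← hpoly, Polynomial.coeff_map]
  rfl

/-- The square of `e₁` is a polynomial in Dickson invariants and `ξ`'s, and square roots are unique;
Steenrod operations carry invariance to the later `e_i`. -/
theorem eInv_mem_orthInvariants {b : Sz F m} (hb : b ^ 2 = bOneSq F m) (k : ℕ) :
    eInv m b k ∈ orthInvariants F m := by
  induction k with
  | zero =>
    have hsq : eInv m b 0 ^ 2 ∈ orthInvariants F m := by
      rw [eInv_zero_sq hb, u_eq_aeval]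
      have hδ : deltaOne F m ∈ orthInvariants F m :=
        Subalgebra.sum_mem _ fun k _ => Subalgebra.sum_mem _ fun j _ =>
          Subalgebra.mul_mem _ (Subalgebra.mul_mem _ (xi_mem_orthInvariants j)
            (xi_mem_orthInvariants k)) (aeval_xi_mem _)
      exact Subalgebra.add_mem _ (dickson_mem_orthInvariants 1) (Subalgebra.mul_mem _
        (Subalgebra.pow_mem _ (aeval_xi_mem _) _) (Subalgebra.add_mem _ hδ
        (Subalgebra.mul_mem _ (xi_mem_orthInvariants 0)
          (Subalgebra.pow_mem _ (aeval_xi_mem _) _))))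
    intro g hg
    have h := hsq g hg
    rw [map_pow] at h
    exact CharTwo.sq_inj.1 h
  | succ k ih =>
    intro g hg
    rw [eInv, ← steenrod_subst, ih g hg]

end Invariance

/-! ### Totally isotropic families. -/

section Isotropic

variable {K : Type*} [Field K] {m : ℕ}

theorem form_smul_right (v v' : Fin (m + m) → K) (c : K) : form v (c • v') = c * form v v' := by
  simp only [form, Pi.smul_apply, smul_eq_mul, Finset.mul_sum]
  exact Finset.sum_congr rfl fun j _ => by ring

theorem form_add_right (v v' v'' : Fin (m + m) → K) :
    form v (v' + v'') = form v v' + form v v'' := by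
  simp only [form, Pi.add_apply, mul_add, Finset.sum_add_distrib]

theorem form_zero_right (v : Fin (m + m) → K) : form v 0 = 0 := by simp [form]

/-- A totally isotropic family of linearly independent vectors has at most `m` members. -/
theorem not_linearIndependent_of_isotropic (ρ : Fin (m + 1) → Fin (m + m) → K)
    (h : ∀ a b, form (ρ a) (ρ b) = 0) : ¬ LinearIndependent K ρ := by
  intro hind
  let A : Matrix (Fin (m + 1)) (Fin (m + m)) K := Matrix.of ρ
  have hA : A.rank = m + 1 := by
    simpa using LinearIndependent.rank_matrix (M := A) hind
  let A' : Matrix (Fin (m + 1)) (Fin (m + m)) K :=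
    A.submatrix (Equiv.refl _) (Fin.revPerm (n := m + m))
  have hA' : A'.rank = m + 1 :=
    (Matrix.rank_submatrix A _ _).trans hA
  -- The product is the Gram matrix, so the two ranks, each `m + 1`, would add up to at most `2m`.
  have hmul : A * A'.transpose = 0 := by
    ext a b
    exact h a b
  have := Matrix.rank_add_rank_le_card_of_mul_eq_zero hmul
  rw [Matrix.rank_transpose, hA, hA', Fintype.card_fin] at this
  omega

end Isotropic

/-! ### The common zero set. -/

section ZeroSet

set_option linter.unusedSectionVars false

variable {F K : Type*} [Field F] [Fintype F] [CharP F 2] [Field K] [Algebra F K] {m : ℕ}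

theorem form_map_row (f : Sz F m →ₐ[F] K) (a b : ℕ) :
    form (fun j => f (w F m j) ^ Fintype.card F ^ a) (fun j => f (w F m j) ^ Fintype.card F ^ b) =
      f (form (row F m a) (row F m b)) := by
  simp only [form, map_sum, map_mul, row, map_pow]

/-- A nontrivial relation between the Frobenius twists of a vector confines all of its twists. -/
theorem exists_span_of_relation {n r : ℕ} (ω : Fin n → K) (c : Fin (r + 1) → K) (hc : c ≠ 0)
    (hrel : ∀ j, ∑ k, c k * ω j ^ Fintype.card F ^ (k : ℕ) = 0) :
    ∃ s ≤ r, ∀ k : ℕ, (fun j => ω j ^ Fintype.card F ^ k) ∈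
      Submodule.span K ((fun (k : ℕ) j => ω j ^ Fintype.card F ^ k) '' {k | k < s}) := by
  classical
  let ρ : ℕ → Fin n → K := fun k j => ω j ^ Fintype.card F ^ k
  have hne : (Finset.univ.filter fun k => c k ≠ 0).Nonempty := by
    obtain ⟨k, hk⟩ := Function.ne_iff.1 hc
    exact ⟨k, Finset.mem_filter.2 ⟨Finset.mem_univ _, hk⟩⟩
  -- The top nonzero coefficient expresses the twist `s` by lower ones.
  set s := (Finset.univ.filter fun k => c k ≠ 0).max' hne with hs
  have hcs : c s ≠ 0 := (Finset.mem_filter.1 (Finset.max'_mem _ hne)).2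
  have hgt : ∀ k, s < k → c k = 0 := by
    intro k hk
    by_contra h
    exact absurd (Finset.le_max' _ k (Finset.mem_filter.2 ⟨Finset.mem_univ _, h⟩)) (not_le.2 hk)
  set W := Submodule.span K (ρ '' {k | k < (s : ℕ)}) with hW
  have hlt : ∀ k : ℕ, k < s → ρ k ∈ W := fun k hk => Submodule.subset_span ⟨k, hk, rfl⟩
  have hsum : ∑ k, c k • ρ k = 0 := by
    ext j
    rw [Finset.sum_apply]
    exact hrel j
  have hsW : ρ s ∈ W := by
    rw [← Finset.add_sum_erase _ _ (Finset.mem_univ s)] at hsum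
    have h1 : c s • ρ s ∈ W := by
      rw [eq_neg_of_add_eq_zero_left hsum]
      refine W.neg_mem (W.sum_mem fun k hk => ?_)
      rcases lt_trichotomy k s with h | h | h
      · exact W.smul_mem _ (hlt k h)
      · exact absurd h (Finset.ne_of_mem_erase hk)
      · rw [hgt k h, zero_smul]
        exact W.zero_mem
    have h2 := W.smul_mem (c s)⁻¹ h1
    rwa [smul_smul, inv_mul_cancel₀ hcs, one_smul] at h2
  -- Frobenius is semilinear and moves each twist to the next, so `W` is stable once it contains the
  -- twist `s`.
  have hfrob : ∀ x ∈ W, (fun j => x j ^ Fintype.card F) ∈ W := by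
    intro x hx
    induction hx using Submodule.span_induction with
    | mem x hx =>
      obtain ⟨k, hk, rfl⟩ := hx
      have h1 : (fun j => ρ k j ^ Fintype.card F) = ρ (k + 1) := by
        funext j
        simp only [ρ, ← pow_mul, ← pow_succ]
      rw [h1]
      have hk : k < s := hk
      rcases Nat.lt_or_ge (k + 1) s with h2 | h2
      · exact hlt _ h2
      · rw [show k + 1 = s by omega]
        exact hsW
    | zero =>
      have h1 : (fun j => (0 : Fin n → K) j ^ Fintype.card F) = 0 := by
        funext j
        simp
      rw [h1]
      exact W.zero_mem
    | add x y _ _ hx hy =>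
      have h1 : (fun j => (x + y) j ^ Fintype.card F) =
          (fun j => x j ^ Fintype.card F) + fun j => y j ^ Fintype.card F := by
        funext j
        exact map_add (FiniteField.frobeniusAlgHom F K) (x j) (y j)
      rw [h1]
      exact W.add_mem hx hy
    | smul a x _ hx =>
      have h1 : (fun j => (a • x) j ^ Fintype.card F) =
          a ^ Fintype.card F • fun j => x j ^ Fintype.card F := by
        funext j
        simp [mul_pow]
      rw [h1]
      exact W.smul_mem _ hx
  refine ⟨s, by omega, fun k => ?_⟩
  change ρ k ∈ W
  induction k with
  | zero =>
    rcases Nat.eq_zero_or_pos (s : ℕ) with h | h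
    · rw [← h]
      exact hsW
    · exact hlt 0 h
  | succ k ih =>
    have h1 : ρ (k + 1) = fun j => ρ k j ^ Fintype.card F := by
      funext j
      simp only [ρ, ← pow_mul, ← pow_succ]
    rw [h1]
    exact hfrob _ ih

/-- If the first `r` Dickson invariants vanish at a point whose coordinates span a space of
dimension at most `r` over the finite field, then the point is the origin. -/
theorem eq_zero_of_dicksonPoly_coeff {n r : ℕ} (ω : Fin n → K)
    (c : Fin (r + 1) → K) (hc : c ≠ 0)
    (hrel : ∀ j, ∑ k, c k * ω j ^ Fintype.card F ^ (k : ℕ) = 0)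
    (hd : ∀ i, 1 ≤ i → i ≤ r → (dicksonPoly F ω).coeff (Fintype.card F ^ (n - i)) = 0) :
    ω = 0 := by
  classical
  set q := Fintype.card F with hq
  have hq1 : 1 < q := Fintype.one_lt_card
  let L : (Fin n → F) →ₗ[F] K := Fintype.linearCombination F ω
  have hL : ∀ a, L a = ∑ j, a j • ω j := fun a => rfl
  have hfr := L.finrank_range_add_finrank_ker
  rw [Module.finrank_fin_fun] at hfr
  -- A nonzero additive polynomial of degree at most `q^r` vanishing on the `F`-span of the
  -- coordinates, which therefore has dimension at most `r`.
  let P : Polynomial K := ∑ k : Fin (r + 1), Polynomial.C (c k) * Polynomial.X ^ q ^ (k : ℕ)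
  have hPc : ∀ k : Fin (r + 1), P.coeff (q ^ (k : ℕ)) = c k := by
    intro k
    simp only [P, Polynomial.finsetSum_coeff, Polynomial.coeff_C_mul, Polynomial.coeff_X_pow]
    rw [Finset.sum_eq_single k]
    · simp
    · intro l _ hl
      rw [if_neg, mul_zero]
      intro h
      exact hl (Fin.ext (Nat.pow_right_injective hq1 h).symm)
    · simp
  have hP0 : P ≠ 0 := by
    intro h
    apply hc
    funext k
    rw [← hPc k, h]
    simp
  have hPd : P.natDegree ≤ q ^ r := by
    refine Polynomial.natDegree_sum_le_of_forall_le _ _ fun k _ => ?_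
    refine (Polynomial.natDegree_C_mul_X_pow_le _ _).trans ?_
    exact Nat.pow_le_pow_right (by omega) (by omega)
  have hPr : ∀ a, P.eval (L a) = 0 := by
    intro a
    simp only [P, Polynomial.eval_finsetSum, Polynomial.eval_mul, Polynomial.eval_C,
      Polynomial.eval_pow, Polynomial.eval_X]
    simp only [hL, hq, sum_smul_pow_card, Finset.mul_sum]
    rw [Finset.sum_comm]
    refine Finset.sum_eq_zero fun j _ => ?_
    simp only [mul_smul_comm, ← Finset.smul_sum]
    rw [hrel j, smul_zero]
  have hrange : Nat.card L.range ≤ q ^ r := by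
    have h1 : Set.range L ⊆ P.roots.toFinset := by
      rintro _ ⟨a, rfl⟩
      simp only [Finset.mem_coe, Multiset.mem_toFinset, Polynomial.mem_roots hP0]
      exact hPr a
    have h2 := Set.ncard_le_ncard h1 (Finset.finite_toSet _)
    rw [Set.ncard_coe_finset] at h2
    exact h2.trans ((Multiset.toFinset_card_le _).trans ((Polynomial.card_roots' P).trans hPd))
  have hrank : Module.finrank F L.range ≤ r := by
    have h1 : Nat.card L.range = Nat.card F ^ Module.finrank F L.range :=
      Module.natCard_eq_pow_finrank
    rw [h1, Nat.card_eq_fintype_card, ← hq] at hrange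
    exact (Nat.pow_le_pow_iff_right hq1).1 hrange
  let S : Finset (Fin n → F) := Finset.univ.filter fun a => L a = 0
  have hS : S.card = q ^ (n - Module.finrank F L.range) := by
    have h1 : Nat.card L.ker = Nat.card F ^ Module.finrank F L.ker :=
      Module.natCard_eq_pow_finrank
    rw [Nat.card_eq_fintype_card (α := F), ← hq,
      show Module.finrank F L.ker = n - Module.finrank F L.range by omega] at h1
    rw [← h1]
    exact (Nat.subtype_card S fun a => by simp [S]).symm
  -- Combinations in the kernel contribute factors `X`, the others nonzero constant terms. So the
  -- lowest exponent is `q^(n - rank)`, where the coefficient would vanish by `hd` if the rank were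
  -- positive.
  have hcoef : (dicksonPoly F ω).coeff S.card ≠ 0 := by
    have h1 : dicksonPoly F ω = Polynomial.X ^ S.card *
        ∏ a ∈ Finset.univ.filter (fun a => ¬ L a = 0), (Polynomial.X + Polynomial.C (L a)) := by
      rw [dicksonPoly, ← Finset.prod_filter_mul_prod_filter_not Finset.univ (fun a => L a = 0)]
      refine congrArg₂ (· * ·) ?_ rfl
      rw [← Finset.prod_const]
      refine Finset.prod_congr rfl fun a ha => ?_
      rw [← hL, (Finset.mem_filter.1 ha).2, Polynomial.C_0, add_zero]
    rw [h1, Polynomial.coeff_X_pow_mul', if_pos le_rfl, Nat.sub_self, Polynomial.coeff_zero_prod,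
      Finset.prod_ne_zero_iff]
    intro a ha
    simpa using (Finset.mem_filter.1 ha).2
  have hzero : Module.finrank F L.range = 0 := by
    by_contra h
    exact hcoef (by rw [hS]; exact hd _ (by omega) hrank)
  have hL0 : L = 0 := by
    rw [← LinearMap.range_eq_bot]
    exact Submodule.finrank_eq_zero.1 hzero
  funext j
  have h1 : L (Pi.single j 1) = ω j := by
    rw [hL]
    simp [Pi.single_apply, ite_smul]
  rw [← h1, hL0]
  rfl

theorem map_dicksonPoly (f : Sz F m →ₐ[F] K) :
    (dicksonPoly F (w F m)).map f.toRingHom = dicksonPoly F fun j => f (w F m j) := by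
  rw [dicksonPoly, Polynomial.map_prod, dicksonPoly]
  refine Finset.prod_congr rfl fun a _ => ?_
  rw [Polynomial.map_add, Polynomial.map_X, Polynomial.map_C]
  simp

/-- The only common zero of `ξ₀, …, ξ_m, e₁, …, e_m` is the origin. -/
theorem eq_zero_of_forall_hFamily {b : Sz F m} (hb : b ^ 2 = bOneSq F m) (v : Var m → K)
    (hv : ∀ i, aeval v (hFamily m b i) = 0) : v = 0 := by
  have : CharP K 2 := charP_of_injective_algebraMap (algebraMap F K).injective 2
  set f : Sz F m →ₐ[F] K := aeval v with hf
  let ω : Fin (m + m) → K := fun j => f (w F m j)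
  let ρ : ℕ → Fin (m + m) → K := fun k j => ω j ^ Fintype.card F ^ k
  have hxi : ∀ k ≤ m, f (xi F m k) = 0 := fun k hk => hv (Sum.inl ⟨k, by omega⟩)
  have he : ∀ k < m, f (eInv m b k) = 0 := fun k hk => hv (Sum.inr ⟨k, hk⟩)
  have hρlt : ∀ a b : ℕ, a < b → b ≤ m → form (ρ a) (ρ b) = 0 := by
    intro a b hab hb
    rw [form_map_row, form_row F m hab, map_pow, hxi _ (by omega),
      zero_pow (pow_ne_zero _ Fintype.card_ne_zero)]
  have hρ : ∀ a b : Fin (m + 1), form (ρ a) (ρ b) = 0 := by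
    intro a b
    rcases lt_trichotomy (a : ℕ) b with h | h | h
    · exact hρlt a b h (by omega)
    · rw [h, form_self]
    · rw [form_comm]
      exact hρlt b a h (by omega)
  have hdep := not_linearIndependent_of_isotropic (fun k : Fin (m + 1) => ρ k) hρ
  rw [Fintype.not_linearIndependent_iff] at hdep
  obtain ⟨c, hc, k₀, hk₀⟩ := hdep
  have hc0 : c ≠ 0 := fun h => hk₀ (by rw [h]; rfl)
  have hrel : ∀ j, ∑ k, c k * ω j ^ Fintype.card F ^ (k : ℕ) = 0 := by
    intro j
    have := congrFun hc j
    rw [Finset.sum_apply] at this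
    exact this
  obtain ⟨s, hs, hspan⟩ := exists_span_of_relation (F := F) ω c hc0 hrel
  -- Every twist lies in the span of those below `s ≤ m`, all orthogonal to `ρ 0`; this extends the
  -- vanishing of `ξ_k` from `k ≤ m` to all `k`.
  have hform : ∀ k, form (ρ 0) (ρ k) = 0 := by
    intro k
    have hx : ∀ x ∈ Submodule.span K (ρ '' {k | k < s}), form (ρ 0) x = 0 := by
      intro x hx
      induction hx using Submodule.span_induction with
      | mem x hx =>
        obtain ⟨k, hk, rfl⟩ := hx
        have hk : k < s := hk
        exact hρ 0 ⟨k, by omega⟩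
      | zero => exact form_zero_right _
      | add x y _ _ hx hy => rw [form_add_right, hx, hy, add_zero]
      | smul a x _ hx => rw [form_smul_right, hx, mul_zero]
    exact hx _ (hspan k)
  have hxi' : ∀ k, f (xi F m k) = 0 := by
    intro k
    rcases Nat.eq_zero_or_pos k with rfl | hk
    · exact hxi 0 (Nat.zero_le _)
    · rw [xi_eq_form F m hk, ← form_map_row]
      exact hform k
  have hideal : ∀ r ∈ xiIdeal F m, f r = 0 := by
    intro r hr
    have hle : xiIdeal F m ≤ RingHom.ker f := by
      rw [xiIdeal, Ideal.span_le]
      rintro _ ⟨k, rfl⟩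
      exact hxi' k
    exact hle hr
  have hdick : ∀ i, 1 ≤ i → i ≤ m → f (dickson F m i) = 0 := by
    intro i hi him
    obtain ⟨i, rfl⟩ := Nat.exists_eq_add_of_le' hi
    obtain ⟨r, hr, h⟩ := eInv_sq_sub_dickson_mem hb i (by omega)
    have h1 := congrArg f h
    rw [map_pow, he i (by omega), map_add, hideal r hr, add_zero, zero_pow two_ne_zero] at h1
    exact h1.symm
  have hω : ω = 0 := by
    refine eq_zero_of_dicksonPoly_coeff (F := F) ω c hc0 hrel fun i hi him => ?_
    rw [← map_dicksonPoly, Polynomial.coeff_map,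
      show m + m - i = 2 * m - i by omega, ← dickson_eq_coeff]
    exact hdick i hi him
  have hvw : ∀ j, v (wVar m j) = 0 := by
    intro j
    have := congrFun hω j
    simpa only [ω, w_eq_X, hf, aeval_X, Pi.zero_apply] using this
  -- Once the `x_j` vanish, `ξ₀` reduces to `z²`.
  have hvz : v (Sum.inr (Sum.inl ())) = 0 := by
    have h0 := hxi 0 (Nat.zero_le _)
    have h1 : xi F m 0 = z F m ^ 2 + ∑ j, x F m j * y F m j := rfl
    have hx : ∀ j, f (x F m j) = 0 := fun j => by
      rw [← w_castAdd]
      exact congrFun hω _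
    rw [h1, map_add, map_sum, map_pow] at h0
    simp only [map_mul, hx, zero_mul, Finset.sum_const_zero, add_zero] at h0
    have h2 := pow_eq_zero_iff two_ne_zero |>.1 h0
    rwa [z, hf, aeval_X] at h2
  funext i
  rcases eq_z_or_exists_wVar m i with rfl | ⟨j, rfl⟩
  · exact hvz
  · exact hvw j

theorem isHomogeneous_hFamily (hm : 1 ≤ m) {b : Sz F m} (hb : b ^ 2 = bOneSq F m)
    (i : Fin (m + 1) ⊕ Fin m) : ∃ d : ℕ, 0 < d ∧ (hFamily m b i).IsHomogeneous d := by
  rcases i with ⟨k, hk⟩ | k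
  · rcases k with _ | k
    · exact ⟨2, two_pos, isHomogeneous_xiZero⟩
    · exact ⟨_, Nat.succ_pos _, isHomogeneous_xi F m (k + 1) (by omega)⟩
  · exact isHomogeneous_eInv hm hb k

theorem hFamily_mem_orthInvariants {b : Sz F m} (hb : b ^ 2 = bOneSq F m)
    (i : Fin (m + 1) ⊕ Fin m) : hFamily m b i ∈ orthInvariants F m := by
  rcases i with k | k
  · exact xi_mem_orthInvariants k
  · exact eInv_mem_orthInvariants hb k

theorem aeval_zero_of_isHomogeneous {σ : Type*} {p : MvPolynomial σ F} {d : ℕ} (hd : 0 < d)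
    (hp : p.IsHomogeneous d) : aeval (0 : σ → K) p = 0 := by
  have h0 : coeff 0 p = 0 := hp.coeff_eq_zero (by simpa using hd.ne)
  have h1 := aeval_zero (S₁ := K) p
  rw [constantCoeff_eq, h0, map_zero] at h1
  exact h1

end ZeroSet

end OddOrth

end

theorem mainTheorem3 {F : Type*} [Field F] [Fintype F] [CharP F 2] (m : ℕ) (hm : 1 ≤ m) :
    MvPolynomial.aeval (OddOrth.xi F (m - 1)) (OddOrth.uPrevPoly F m) = OddOrth.u F (m - 1) ∧
    (∃! b : OddOrth.Sz F m, b ^ 2 = OddOrth.bOneSq F m) ∧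
    ∀ b : OddOrth.Sz F m, b ^ 2 = OddOrth.bOneSq F m →
      OddOrth.IsHSOP (OddOrth.orthInvariants F m) (OddOrth.hFamily m b) ∧
      {v : OddOrth.Var m → AlgebraicClosure F |
        ∀ i, MvPolynomial.aeval v (OddOrth.hFamily m b i) = 0} = {0} := by
  refine ⟨OddOrth.aeval_uPrevPoly F m hm, OddOrth.existsUnique_sq_eq_bOneSq hm, fun b hb => ?_⟩
  have hz := fun v : OddOrth.Var m → AlgebraicClosure F =>
    OddOrth.eq_zero_of_forall_hFamily (m := m) hb v
  refine ⟨OddOrth.isHSOP_of_forall_zero (K := AlgebraicClosure F) ?_ _ _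
    (OddOrth.hFamily_mem_orthInvariants hb) (OddOrth.isHomogeneous_hFamily hm hb) hz, ?_⟩
  · simp only [Nat.card_eq_fintype_card, OddOrth.Var, Fintype.card_sum, Fintype.card_fin,
      Fintype.card_unit]
    omega
  · refine Set.eq_singleton_iff_unique_mem.2 ⟨fun i => ?_, fun v hv => hz v hv⟩
    obtain ⟨d, hd, h⟩ := OddOrth.isHomogeneous_hFamily hm hb i
    exact OddOrth.aeval_zero_of_isHomogeneous hd h
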